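/- Let $M$ be a smooth $m$-dimensional manifold without boundary (for example a closed submanifold $\Gamma^0\subset\mathbb R^n$), let $T>0$, and let $X\colon M\times[0,T]\to\mathbb R^n$ be smooth and such that $X(\cdot,t)$ is an immersion for every $t\in[0,T]$ (for example an embedding). Write $\Gamma=\Gamma(t)$ for the submanifold parametrized by $X(\cdot,t)$; functions on $\Gamma(t)$ are regarded as functions of the parameter $p\in M$. In local coordinates let $g_{ij}=\partial_iX\cdot\partial_jX$ be the induced metric with inverse $(g^{ij})$, let $$\pi=\sum_{i,j=1}^m g^{ij}\,\partial_iX\otimes\partial_jX\in\mathbb R^{n\times n}$$ be the orthogonal projection onto the tangent space of $\Gamma$, let $A_{ij}=(I-\pi)\,\partial_i\partial_jX$ be the second fundamental form and $H=\sum_{i,j}g^{ij}A_{ij}\in\mathbb R^n$ the mean curvature vector. For a scalar function $u$ on $\Gamma$ let $\nabla_\Gamma u=\sum_{i,j}g^{ij}\,\partial_iu\,\partial_jX$ be the tangential gradient and $\Delta_\Gamma u=\nabla_\Gamma\cdot\nabla_\Gamma u$ the Laplace--Beltrami operator, where $\nabla_\Gamma\cdot W=\sum_{\alpha=1}^n(\nabla_\Gamma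 W_\alpha)_\alpha$; on matrix- and vector-valued functions $\Delta_\Gamma$ acts componentwise. Let $\partial^\circ u$ be the material derivative, that is, the time derivative at fixed $p\in M$ (one-sided at $t=0$ and $t=T$). Suppose that $X$ moves by mean curvature flow, that is, $\partial_tX(p,t)=H(p,t)$ for all $p\in M$ and $t\in[0,T]$. Then, at every $p\in M$ and $t\in[0,T]$, the material derivatives of $\pi$ and $H$ exist and $$\partial^\circ\pi=\Delta_\Gamma\pi+f_1(\pi),\qquad \partial^\circ H=\Delta_\Gamma H+f_2(\pi,H),$$ where, for $\alpha,\beta=1,\dots,n$, $$f_1(\pi)_{\alpha\beta}=2\sum_{\mu=1}^n\nabla_\Gamma\pi_{\alpha\mu}\cdot\nabla_\Gamma\pi_{\beta\mu}-4\sum_{\mu,\kappa=1}^n\pi_{\mu\kappa}\,\nabla_\Gamma\pi_{\alpha\mu}\cdot\nabla_\Gamma\pi_{\beta\kappa},$$ $$f_2(\pi,H)_\alpha=2\sum_{\mu=1}^n\nabla_\Gamma\pi_{\alpha\mu}\cdot\nabla_\Gamma H_\mu+4\sum_{\mu,\kappa=1}^n\bigl(\nabla_\Gamma\pi_{\alpha\mu}\cdot\nabla_\Gamma\pi_{\mu\kappa}\bigr)H_\kappa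 .$$ -/

import Mathlib

open Set
open scoped Manifold ContDiff

noncomputable section

namespace HigherCodimMCF

/- Throughout, `M` is an `m`-dimensional manifold without boundary, and a map
`F : M → EuclideanSpace ℝ (Fin n)` (an immersion) parametrizes the submanifold `Γ = F(M)`.
Functions on `Γ` are written as functions of the parameter `p : M`, i.e. `u(F(p))` is `u p`. -/

section Static

variable {m n : ℕ} {M : Type*} [TopologicalSpace M] [ChartedSpace (EuclideanSpace ℝ (Fin m)) M]

/-- The partial derivative `∂ᵢ u (p)` in the preferred chart of `M` at `p` (the manifold derivative
of Mathlib is the derivative in that chart). -/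
def partialDeriv {V : Type*} [NormedAddCommGroup V] [NormedSpace ℝ V]
    (u : M → V) (i : Fin m) (p : M) : V :=
  mfderiv 𝓘(ℝ, EuclideanSpace ℝ (Fin m)) 𝓘(ℝ, V) u p
    (EuclideanSpace.single i (1 : ℝ) : EuclideanSpace ℝ (Fin m))

/-- The second partial derivative `∂ᵢ ∂ⱼ F (p)` in the preferred chart of `M` at `p`. -/
def partialDeriv₂ {V : Type*} [NormedAddCommGroup V] [NormedSpace ℝ V]
    (F : M → V) (i j : Fin m) (p : M) : V :=
  fderiv ℝ
    (fun y => fderiv ℝ (F ∘ (extChartAt 𝓘(ℝ, EuclideanSpace ℝ (Fin m)) p).symm) y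
      (EuclideanSpace.single j (1 : ℝ)))
    (extChartAt 𝓘(ℝ, EuclideanSpace ℝ (Fin m)) p p)
    (EuclideanSpace.single i (1 : ℝ))

variable (m)

/-- The induced metric `g i j = ⟨∂ᵢ F, ∂ⱼ F⟩` at `p`. -/
def metric (F : M → EuclideanSpace ℝ (Fin n)) (p : M) : Matrix (Fin m) (Fin m) ℝ :=
  Matrix.of fun i j => inner ℝ (partialDeriv F i p) (partialDeriv F j p)

/-- The inverse metric `g^{ij}` at `p`. -/
def invMetric (F : M → EuclideanSpace ℝ (Fin n)) (p : M) : Matrix (Fin m) (Fin m) ℝ :=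
  (metric m F p)⁻¹

/-- The orthogonal projection onto the tangent space, as an `n × n` matrix:
`π = ∑ᵢⱼ g^{ij} ∂ᵢ F ⊗ ∂ⱼ F`. -/
def tangentProj (F : M → EuclideanSpace ℝ (Fin n)) (p : M) : Matrix (Fin n) (Fin n) ℝ :=
  Matrix.of fun α β =>
    ∑ i, ∑ j, invMetric m F p i j * partialDeriv F i p α * partialDeriv F j p β

/-- The component `w^⊥ = w - π w` of a vector `w` normal to the submanifold at `p`. -/
def normalPart (F : M → EuclideanSpace ℝ (Fin n)) (p : M) (w : EuclideanSpace ℝ (Fin n)) :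
    EuclideanSpace ℝ (Fin n) :=
  w - Matrix.toEuclideanLin (tangentProj m F p) w

/-- The second fundamental form `A i j = (∂ᵢ ∂ⱼ F)^⊥`. -/
def secondFundForm (F : M → EuclideanSpace ℝ (Fin n)) (i j : Fin m) (p : M) :
    EuclideanSpace ℝ (Fin n) :=
  normalPart m F p (partialDeriv₂ F i j p)

/-- The mean curvature vector `H = ∑ᵢⱼ g^{ij} A i j`. -/
def meanCurv (F : M → EuclideanSpace ℝ (Fin n)) (p : M) : EuclideanSpace ℝ (Fin n) :=
  ∑ i, ∑ j, invMetric m F p i j • secondFundForm m F i j p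

/-- The tangential gradient `∇_Γ u = ∑ᵢⱼ g^{ij} ∂ᵢ u ∂ⱼ F`. -/
def tangGrad (F : M → EuclideanSpace ℝ (Fin n)) (u : M → ℝ) (p : M) : EuclideanSpace ℝ (Fin n) :=
  ∑ i, ∑ j, (invMetric m F p i j * partialDeriv u i p) • partialDeriv F j p

/-- The tangential divergence `∇_Γ · W = ∑_α (∇_Γ W_α)_α` of a field `W : Γ → ℝⁿ`. -/
def tangDiv (F : M → EuclideanSpace ℝ (Fin n)) (W : M → EuclideanSpace ℝ (Fin n)) (p : M) : ℝ :=
  ∑ α, tangGrad m F (fun q => W q α) p α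

/-- The Laplace–Beltrami operator `Δ_Γ u = ∇_Γ · ∇_Γ u`. -/
def laplaceBeltrami (F : M → EuclideanSpace ℝ (Fin n)) (u : M → ℝ) (p : M) : ℝ :=
  tangDiv m F (tangGrad m F u) p

/-- The nonlinearity `f₁(P)` for a matrix field `P` on the submanifold. -/
def f₁ (F : M → EuclideanSpace ℝ (Fin n)) (P : M → Matrix (Fin n) (Fin n) ℝ) (p : M) :
    Matrix (Fin n) (Fin n) ℝ :=
  Matrix.of fun α β =>
    2 * ∑ μ, inner ℝ (tangGrad m F (fun q => P q α μ) p) (tangGrad m F (fun q => P q β μ) p)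
    - 4 * ∑ μ, ∑ κ, P p μ κ *
        inner ℝ (tangGrad m F (fun q => P q α μ) p) (tangGrad m F (fun q => P q β κ) p)

/-- The component `α` of the nonlinearity `f₂(P, Y)` for a matrix field `P` and a vector field `Y`
on the submanifold. -/
def f₂ (F : M → EuclideanSpace ℝ (Fin n)) (P : M → Matrix (Fin n) (Fin n) ℝ)
    (Y : M → EuclideanSpace ℝ (Fin n)) (p : M) (α : Fin n) : ℝ :=
  2 * ∑ μ, inner ℝ (tangGrad m F (fun q => P q α μ) p) (tangGrad m F (fun q => Y q μ) p)
  + 4 * ∑ μ, ∑ κ,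
      inner ℝ (tangGrad m F (fun q => P q α μ) p) (tangGrad m F (fun q => P q μ κ) p) * Y p κ

end Static

/-- The material derivative at time `t` of the particle labelled `p` exists and equals `d`. A
quantity `u` on the moving submanifold is given as `u s p = u(X(p, s), s)`, so this is the
derivative in time along the particle (one-sided at the end points of `[0, T]`). -/
def HasMaterialDeriv {M : Type*} (T : ℝ) (u : ℝ → M → ℝ) (d : ℝ) (t : ℝ) (p : M) : Prop :=
  HasDerivWithinAt (fun s => u s p) d (Icc 0 T) t

section Flow

variable (m : ℕ) {n : ℕ} {M : Type*} [TopologicalSpace M]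
  [ChartedSpace (EuclideanSpace ℝ (Fin m)) M]

/-- `X : M × [0, T] → ℝⁿ` (with the time written first) is a smooth family of immersions that moves
by mean curvature: `∂ₜ X = H`. Smoothness includes the end points of `[0, T]`, where the time
derivative is one-sided. -/
structure IsMeanCurvatureFlow (T : ℝ) (X : ℝ → M → EuclideanSpace ℝ (Fin n)) : Prop where
  smooth : ContMDiffOn (𝓘(ℝ, ℝ).prod 𝓘(ℝ, EuclideanSpace ℝ (Fin m)))
    𝓘(ℝ, EuclideanSpace ℝ (Fin n)) ∞ (fun z : ℝ × M => X z.1 z.2) (Icc 0 T ×ˢ univ)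
  immersion : ∀ t ∈ Icc 0 T, ∀ p : M, Function.Injective
    (mfderiv 𝓘(ℝ, EuclideanSpace ℝ (Fin m)) 𝓘(ℝ, EuclideanSpace ℝ (Fin n)) (X t) p)
  velocity : ∀ t ∈ Icc 0 T, ∀ p : M,
    HasDerivWithinAt (fun s => X s p) (meanCurv m (X t) p) (Icc 0 T) t

end Flow

end HigherCodimMCF

end

open HigherCodimMCF

/-! Fix a chart. Let `L` be the differential of the immersion, `R = (L†L)⁻¹L†` its pseudoinverse and
`P = L R` the tangential projection. Contractions with `g^{ij}` become sums over an ambient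
orthonormal basis, since `∑ g^{ij} b(∂ᵢ, ∂ⱼ) = ∑ b(R e_γ, R e_γ)`; the component `γ` of a tangential
gradient is `du (R e_γ)`. Differentiating `P L = L` shows that `dP v (L w)` is the second
fundamental form, and its trace gives `H = ∑ dP (R e_γ) e_γ`.

For the projection, write `Ṗ`, `ΔP` for the time derivative and Laplacian and split matrices into
tangential and normal blocks. From `P² = P`, `Ṗ` has only off-diagonal blocks; from `P L = L` and
`∂ₜL = dH`, they are given by the normal part of `dH`. The traced Codazzi equation
(`ImmersionJet.codazzi`) says that `ΔP` has the same off-diagonal blocks. Its diagonal blocks follow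
from the Laplacian of `P² = P`, namely `ΔP·P + 2S + P·ΔP = ΔP` with `S = ∑ dP dP`. Hence `Ṗ - ΔP =
4PS - 2S`, which is `f₁` because `∑ dP P dP = S - PS`.

For the mean curvature, differentiate `H = ∑ (1 - P) Q(R e, R e)` in time, where `Q` is the second
derivative of the immersion. The evolution of `P`, together with the first and second derivatives of
`P H = 0`, turns the result into `ΔH + f₂`. Both arguments are pointwise algebra in `ImmersionJet`.

The analysis supplies the algebraic hypotheses: `SmoothImmersionOn.jet` gives the spatial relations,
`hasDerivWithinAt_fderiv` commutes time and space derivatives up to the end points, and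
`IsImmersion` identifies the coordinate definitions, made in a chart varying with the point, with
expressions in one fixed chart. -/

namespace HigherCodimMCF

/-! ### Pointwise algebra of the jet of an immersion, and the two evolution equations. -/

section Algebra

variable {E F V ι : Type*} [NormedAddCommGroup E] [NormedSpace ℝ E]
  [NormedAddCommGroup F] [InnerProductSpace ℝ F] [CompleteSpace F]
  [NormedAddCommGroup V] [NormedSpace ℝ V] [Fintype ι]

/-- Pointwise relations between the derivatives up to third order of an immersion: `L` is its
differential, `R` the pseudoinverse of `L`, `P = L R` the tangential projection, `Q` the second
derivative, and `dR`, `dP`, `ddP` the derivatives of `R` and `P`. -/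
structure ImmersionJet (L : E →L[ℝ] F) (R : F →L[ℝ] E) (P : F →L[ℝ] F)
    (Q : E →L[ℝ] E →L[ℝ] F) (dR : E →L[ℝ] F →L[ℝ] E) (dP : E →L[ℝ] F →L[ℝ] F)
    (ddP : E →L[ℝ] E →L[ℝ] F →L[ℝ] F) : Prop where
  left_inv : ∀ v, R (L v) = v
  right_inv : ∀ x, L (R x) = P x
  selfAdjoint : IsSelfAdjoint P
  selfAdjoint_d : ∀ v, IsSelfAdjoint (dP v)
  selfAdjoint_dd : ∀ v w, IsSelfAdjoint (ddP v w)
  Q_symm : ∀ v w, Q v w = Q w v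
  ddP_symm : ∀ v w, ddP v w = ddP w v
  dP_L : ∀ v w, dP v (L w) + P (Q v w) = Q v w
  L_dR : ∀ v x, Q v (R x) + L (dR v x) = dP v x
  dP_idem : ∀ v, dP v * P + P * dP v = dP v
  ddP_idem : ∀ v w, ddP v w * P + dP w * dP v + dP v * dP w + P * ddP v w = ddP v w
  ddP_L : ∀ z v w, ddP z v (L w) + dP v (Q z w) = ddP z w (L v) + dP w (Q z v)

/-- Under the trace, a self-adjoint `P` moves from one slot to the other, where `R` absorbs it. This
makes it possible to trace over the ambient basis instead of a tangent frame. -/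
theorem sum_apply_selfAdjoint (e : OrthonormalBasis ι ℝ F) {R : F →L[ℝ] E} {P : F →L[ℝ] F}
    (hP : IsSelfAdjoint P) (hR : ∀ x, R (P x) = R x) (b : E →L[ℝ] F →L[ℝ] V) (S : F →L[ℝ] F) :
    ∑ i, b (R (e i)) (S (P (e i))) = ∑ i, b (R (e i)) (S (e i)) := by
  have h1 : ∀ i, P (e i) = ∑ j, inner ℝ (P (e j)) (e i) • e j := fun i => by
    conv_lhs => rw [← e.sum_repr' (P (e i))]
    refine Finset.sum_congr rfl fun j _ => ?_
    congr 1
    have := ContinuousLinearMap.isSelfAdjoint_iff_isSymmetric.1 hP (e j) (e i)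
    exact this.symm
  have h2 : ∀ j, R (e j) = ∑ i, inner ℝ (P (e j)) (e i) • R (e i) := fun j => by
    rw [← hR]
    conv_lhs => rw [← e.sum_repr' (P (e j))]
    simp only [map_sum, map_smul]
    refine Finset.sum_congr rfl fun i _ => ?_
    rw [real_inner_comm]
  calc ∑ i, b (R (e i)) (S (P (e i)))
      = ∑ i, ∑ j, inner ℝ (P (e j)) (e i) • b (R (e i)) (S (e j)) := by
        refine Finset.sum_congr rfl fun i _ => ?_
        rw [h1 i]; simp only [map_sum, map_smul]
    _ = ∑ j, b (∑ i, inner ℝ (P (e j)) (e i) • R (e i)) (S (e j)) := by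
        rw [Finset.sum_comm]
        refine Finset.sum_congr rfl fun j _ => ?_
        simp only [map_sum, map_smul, sum_apply,
          smul_apply]
    _ = _ := by simp only [← h2]

namespace ImmersionJet

variable {L : E →L[ℝ] F} {R : F →L[ℝ] E} {P : F →L[ℝ] F}
    {Q : E →L[ℝ] E →L[ℝ] F} {dR : E →L[ℝ] F →L[ℝ] E} {dP : E →L[ℝ] F →L[ℝ] F}
    {ddP : E →L[ℝ] E →L[ℝ] F →L[ℝ] F} (J : ImmersionJet L R P Q dR dP ddP)
    (e : OrthonormalBasis ι ℝ F)

include J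

theorem P_L (v : E) : P (L v) = L v := by rw [← J.right_inv, J.left_inv]
theorem R_P (x : F) : R (P x) = R x := by rw [← J.right_inv, J.left_inv]
theorem P_P (x : F) : P (P x) = P x := by rw [← J.right_inv x, J.P_L]

theorem idem : P * P = P := by ext1 x; exact J.P_P x

theorem dP_idem_apply (v : E) (x : F) : dP v (P x) + P (dP v x) = dP v x := by
  simpa using congrArg (fun f => f x) (J.dP_idem v)

/-- The derivative of a projection exchanges tangential and normal vectors; evaluating the
differentiated idempotency on `P x` leaves only this block. -/
theorem P_dP_P (v : E) (x : F) : P (dP v (P x)) = 0 := by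
  have h := J.dP_idem_apply v (P x)
  rw [J.P_P] at h
  simpa using h

theorem dP_L_symm (v w : E) : dP v (L w) = dP w (L v) := by
  have h1 := J.dP_L v w
  have h2 := J.dP_L w v
  rw [J.Q_symm w v] at h2
  exact add_right_cancel (h1.trans h2.symm)

theorem dP_L' (v w : E) : dP v (L w) = Q v w - P (Q v w) := eq_sub_of_add_eq (J.dP_L v w)

/-- Inserting `P = L R` under the trace turns each term into the second fundamental form, so the
divergence of the projection is the mean curvature vector. -/
theorem sum_dP_normal :
    ∑ i, dP (R (e i)) (e i) = ∑ i, (Q (R (e i)) (R (e i)) - P (Q (R (e i)) (R (e i)))) := by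
  refine (sum_apply_selfAdjoint e J.selfAdjoint J.R_P dP (ContinuousLinearMap.id ℝ F)).symm.trans
    (Finset.sum_congr rfl fun i _ => ?_)
  rw [← J.dP_L', J.right_inv]; rfl

theorem P_sum_dP : P (∑ i, dP (R (e i)) (e i)) = 0 := by
  rw [J.sum_dP_normal]; simp [J.P_P]

/-- The vector `∑ dR (R e) e` is the first-order coefficient of the Laplacian in coordinates;
tracing the derivative of `L R = P` computes its image. -/
theorem L_sum_dR :
    L (∑ i, dR (R (e i)) (e i)) = ∑ i, dP (R (e i)) (e i) - ∑ i, Q (R (e i)) (R (e i)) := by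
  rw [map_sum, ← Finset.sum_sub_distrib]
  refine Finset.sum_congr rfl fun i _ => ?_
  rw [← J.L_dR]; abel

/-- The Codazzi equation, traced: the normal part of `(Δ P) L w` is that of the derivative of the
mean curvature vector in the direction `w`. -/
theorem codazzi (w : E) :
    (1 - P) ((∑ i, ddP (R (e i)) (R (e i)) + dP (∑ i, dR (R (e i)) (e i))) (L w)) =
      (1 - P) (∑ i, (ddP w (R (e i)) (e i) + dP (dR w (e i)) (e i))) := by
  have hN : ∀ v x, (1 - P) (dP v x) = dP v (P x) := fun v x => by
    have := J.dP_idem_apply v x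
    simp only [sub_apply, one_apply_eq_self]
    exact sub_eq_of_eq_add this.symm
  have h1 : ∑ i, ddP w (R (e i)) (P (e i)) = ∑ i, ddP w (R (e i)) (e i) :=
    sum_apply_selfAdjoint e J.selfAdjoint J.R_P (ddP w) (ContinuousLinearMap.id ℝ F)
  -- The derivative of the symmetry of the second fundamental form, with one argument traced.
  have h2 : ∀ i, ddP (R (e i)) (R (e i)) (L w) = ddP w (R (e i)) (P (e i))
      + dP w (Q (R (e i)) (R (e i))) - dP (R (e i)) (Q w (R (e i))) := fun i => by
    have := J.ddP_L (R (e i)) (R (e i)) w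
    rw [J.right_inv, J.ddP_symm _ w, J.Q_symm _ w] at this
    exact eq_sub_of_add_eq this
  have h3 : ∀ i, (1 - P) (dP (dR w (e i)) (e i)) =
      dP (R (e i)) (dP w (e i)) - dP (R (e i)) (Q w (R (e i))) := fun i => by
    rw [hN, ← J.right_inv, J.dP_L_symm, ← J.L_dR w, map_add]; abel
  -- The trace allows `e i` to be replaced by `P (e i)`; then `dP w` makes it normal, and the next
  -- `dP` makes it tangential, so `1 - P` kills it.
  have h4 : (1 - P) (∑ i, dP (R (e i)) (dP w (e i))) = 0 := by
    rw [← sum_apply_selfAdjoint e J.selfAdjoint J.R_P dP (dP w), map_sum]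
    refine Finset.sum_eq_zero fun i _ => ?_
    rw [hN, J.P_dP_P, map_zero]
  have h5 : (1 - P) (dP w (∑ i, dP (R (e i)) (e i))) = 0 := by
    rw [hN, J.P_sum_dP, map_zero]
  have h6 : ∀ x, (1 - P) ((1 - P) x) = (1 - P) x := fun x => by
    simp [J.P_P]
  have h7 : (1 - P) (∑ i, dP (dR w (e i)) (e i)) =
      - (1 - P) (∑ i, dP (R (e i)) (Q w (R (e i)))) := by
    -- The normal projection is applied twice: one copy is used up by `h3`, the other removes the
    -- term of `h4`.
    rw [← h6, map_sum (1 - P) (fun i => dP (dR w (e i)) (e i))]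
    simp only [h3, Finset.sum_sub_distrib]
    rw [map_sub, h4, zero_sub]
  have h8 : dP (∑ i, dR (R (e i)) (e i)) (L w) =
      dP w (∑ i, dP (R (e i)) (e i)) - ∑ i, dP w (Q (R (e i)) (R (e i))) := by
    rw [J.dP_L_symm, J.L_sum_dR, map_sub, map_sum (dP w) (fun i => Q (R (e i)) (R (e i)))]
  rw [add_apply, sum_apply, h8]
  simp only [h2, Finset.sum_add_distrib, Finset.sum_sub_distrib, h1]
  rw [map_add (1 - P), map_add (1 - P), h7, map_sub (1 - P), map_sub (1 - P), map_add (1 - P), h5]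
  abel

/-- The evolution equation of the tangential projection, at one point. -/
theorem proj_evolution {dH : E →L[ℝ] F}
    (hdH : ∀ w, dH w = ∑ i, (ddP w (R (e i)) (e i) + dP (dR w (e i)) (e i)))
    {Pdot : F →L[ℝ] F} (hsa : IsSelfAdjoint Pdot)
    (hidem : Pdot * P + P * Pdot = Pdot)
    (hL : ∀ w, Pdot (L w) = (1 - P) (dH w)) :
    Pdot = (∑ i, ddP (R (e i)) (R (e i)) + dP (∑ i, dR (R (e i)) (e i)))
      + (2 * ∑ i, dP (R (e i)) * dP (R (e i)) - 4 * ∑ i, dP (R (e i)) * P * dP (R (e i))) := by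
  set τ := ∑ i, dR (R (e i)) (e i) with hτ
  set Δ := ∑ i, ddP (R (e i)) (R (e i)) + dP τ with hΔ
  set S := ∑ i, dP (R (e i)) * dP (R (e i)) with hS
  set N := ∑ i, dP (R (e i)) * P * dP (R (e i)) with hN
  have hPdP : ∀ v, P * dP v = dP v - dP v * P := fun v => eq_sub_of_add_eq' (J.dP_idem v)
  -- Each `dP` exchanges the tangential and normal spaces, so its square preserves both.
  have hSP : S * P = P * S := by
    simp only [hS, Finset.sum_mul, Finset.mul_sum]
    refine Finset.sum_congr rfl fun i _ => ?_
    set A := dP (R (e i))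
    have := hPdP (R (e i))
    have h' : A * P = A - P * A := by rw [this]; abel
    rw [mul_assoc, h', mul_sub, ← mul_assoc, h', sub_mul, ← mul_assoc]; abel
  have hNS : N = S - P * S := by
    rw [← hSP]
    simp only [hN, hS, Finset.sum_mul, ← Finset.sum_sub_distrib]
    refine Finset.sum_congr rfl fun i _ => ?_
    rw [mul_assoc, hPdP, mul_sub, ← mul_assoc]
  -- The Laplacian of `P² = P`; the cross terms of the product rule give `2 * S`.
  have hΔidem : Δ * P + 2 * S + P * Δ = Δ := by
    have h1 : Δ * P + 2 * S + P * Δ =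
        ∑ i, (ddP (R (e i)) (R (e i)) * P + dP (R (e i)) * dP (R (e i))
          + dP (R (e i)) * dP (R (e i)) + P * ddP (R (e i)) (R (e i)))
        + (dP τ * P + P * dP τ) := by
      simp only [hΔ, hS, add_mul, mul_add, Finset.sum_add_distrib, Finset.sum_mul, Finset.mul_sum,
        two_mul]
      abel
    rw [h1, J.dP_idem]
    simp only [J.ddP_idem, hΔ]
  -- Codazzi: `Pdot` and `Δ` send a tangent vector to the same normal part, that of `dH`. The
  -- opposite block follows by taking adjoints.
  have hcod : (1 - P) * (Pdot - Δ) * P = 0 := by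
    ext1 x
    have h1 : Pdot (P x) = (1 - P) (dH (R x)) := by rw [← J.right_inv, hL]
    have h2 := J.codazzi e (R x)
    rw [← hdH, ← hτ, ← hΔ, J.right_inv] at h2
    simp only [mul_apply_eq_comp, sub_apply,
      one_apply_eq_self, zero_apply] at h1 h2 ⊢
    rw [h1, map_sub, map_sub, J.P_P]
    rw [← h2]; abel
  have hXsa : star (Pdot - Δ) = Pdot - Δ := by
    have h1 : star Δ = Δ := by
      simp only [hΔ, star_add, star_sum, (J.selfAdjoint_dd _ _).star_eq,
        (J.selfAdjoint_d _).star_eq]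
    rw [star_sub, h1, hsa.star_eq]
  have hcod' : P * (Pdot - Δ) * (1 - P) = 0 := by
    have := congrArg star hcod
    rwa [star_mul, star_mul, hXsa, J.selfAdjoint.star_eq, star_sub 1 P, star_one,
      J.selfAdjoint.star_eq, star_zero, ← mul_assoc] at this
  -- block decomposition of `Y = Pdot - Δ`
  set Y := Pdot - Δ with hY
  have hYidem : Y * P + P * Y = Y + 2 * S := by
    have h1 : Y * P + P * Y = (Pdot * P + P * Pdot) - (Δ * P + 2 * S + P * Δ) + 2 * S := by
      simp only [hY, sub_mul, mul_sub]; abel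
    rw [h1, hidem, hΔidem]
  have h1 : Y * P = P * Y * P := by
    have : Y * P - P * Y * P = 0 := by rw [← hcod]; noncomm_ring
    exact sub_eq_zero.1 this
  have h2 : P * Y = P * Y * P := by
    have : P * Y - P * Y * P = 0 := by rw [← hcod']; noncomm_ring
    exact sub_eq_zero.1 this
  -- The tangential block occurs twice on the left of `hYidem` and once on the right, so one copy
  -- cancels.
  have h3 : P * Y * P = 2 * (P * S) := by
    have h4 := congrArg (fun Z => P * Z) hYidem
    simp only [mul_add, ← mul_assoc, J.idem] at h4
    have h5 : P * 2 * S = 2 * (P * S) := by noncomm_ring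
    rw [h5, add_comm] at h4
    exact add_left_cancel h4
  -- The off-diagonal blocks of `Y` vanish, so `Y * P` and `P * Y` both equal the tangential block.
  have h4 : Y = 4 * (P * S) - 2 * S := by
    calc Y = (Y * P + P * Y) - 2 * S := by rw [hYidem]; abel
      _ = (P * Y * P + P * Y * P) - 2 * S :=
        congrArg (· - 2 * S) (congrArg₂ (· + ·) h1 h2)
      _ = _ := by rw [h3]; noncomm_ring
  have h5 : Pdot = Δ + Y := by rw [hY]; abel
  rw [h5, h4, hNS]; noncomm_ring

/-- The evolution equation of the mean curvature vector, at one point. -/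
theorem meanCurv_evolution {H : F} {dH : E →L[ℝ] F} {ddH : E →L[ℝ] E →L[ℝ] F}
    (hH : H = ∑ i, dP (R (e i)) (e i))
    (hPdH : ∀ v, P (dH v) + dP v H = 0)
    (hPddH : ∀ v w, P (ddH v w) + dP v (dH w) + dP w (dH v) + ddP v w H = 0)
    {Pdot : F →L[ℝ] F} {Rdot : F →L[ℝ] E}
    (hL : ∀ w, Pdot (L w) = (1 - P) (dH w))
    (hLR : ∀ x, dH (R x) + L (Rdot x) = Pdot x)
    (hev : Pdot = (∑ i, ddP (R (e i)) (R (e i)) + dP (∑ i, dR (R (e i)) (e i)))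
      + (2 * ∑ i, dP (R (e i)) * dP (R (e i)) - 4 * ∑ i, dP (R (e i)) * P * dP (R (e i)))) :
    ∑ i, (-Pdot (Q (R (e i)) (R (e i))) + (1 - P) (ddH (R (e i)) (R (e i))
        + Q (Rdot (e i)) (R (e i)) + Q (R (e i)) (Rdot (e i)))) =
      (∑ i, ddH (R (e i)) (R (e i)) + dH (∑ i, dR (R (e i)) (e i)))
      + ((2 : ℝ) • ∑ i, dP (R (e i)) (dH (R (e i)))
        + (4 : ℝ) • ∑ i, dP (R (e i)) (dP (R (e i)) H)) := by
  set τ := ∑ i, dR (R (e i)) (e i) with hτ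
  have hPH : P H = 0 := by rw [hH, J.P_sum_dP]
  have hPdPH : ∀ v, P (dP v H) = dP v H := fun v => by
    have := J.dP_idem_apply v H
    rwa [hPH, map_zero, zero_add] at this
  have hN : ∀ v w, (1 - P) (Q v w) = dP v (L w) := fun v w => by
    rw [J.dP_L']; rfl
  -- The trace of `Q` has normal part `H` and tangential part `-L τ`; `hL` handles the latter.
  have h1 : ∑ i, Pdot (Q (R (e i)) (R (e i))) = Pdot H - (dH τ - P (dH τ)) := by
    have := J.L_sum_dR e
    rw [← hH, ← hτ] at this
    have h2 : ∑ i, Q (R (e i)) (R (e i)) = H - L τ := by rw [this]; abel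
    rw [← map_sum, h2, map_sub, hL]; rfl
  have h2 : ∑ i, dP (R (e i)) (Pdot (e i)) = ∑ i, dP (R (e i)) (dH (R (e i)) - P (dH (R (e i)))) := by
    rw [← sum_apply_selfAdjoint e J.selfAdjoint J.R_P dP Pdot]
    refine Finset.sum_congr rfl fun i _ => ?_
    rw [← J.right_inv, hL]; rfl
  -- The normal parts of `dH` cancel between `Pdot` and `dH`, leaving `-P dH`, which is `dP H`
  -- because `P H = 0`. By the symmetry of `Q` this sum occurs twice, giving half of the coefficient
  -- 4.
  have h3 : ∑ i, dP (R (e i)) (L (Rdot (e i))) = ∑ i, dP (R (e i)) (dP (R (e i)) H) := by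
    have h4 : ∀ i, L (Rdot (e i)) = Pdot (e i) - dH (R (e i)) := fun i => by
      rw [← hLR]; abel
    simp only [h4, map_sub, Finset.sum_sub_distrib, h2]
    rw [sub_sub_cancel_left, ← Finset.sum_neg_distrib]
    refine Finset.sum_congr rfl fun i _ => ?_
    rw [← map_neg, ← eq_neg_of_add_eq_zero_right (hPdH (R (e i)))]
  have h5 : ∑ i, P (ddH (R (e i)) (R (e i))) = - (2 : ℝ) • ∑ i, dP (R (e i)) (dH (R (e i)))
      - (∑ i, ddP (R (e i)) (R (e i))) H := by
    rw [sum_apply, Finset.smul_sum, ← Finset.sum_sub_distrib]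
    refine Finset.sum_congr rfl fun i _ => ?_
    have := hPddH (R (e i)) (R (e i))
    rw [neg_smul, two_smul]
    rw [← sub_eq_zero, ← this]; abel
  have h6 : P (dH τ) = - dP τ H := eq_neg_of_add_eq_zero_left (hPdH τ)
  have h7 := congrArg (fun f => f H) hev
  -- Since `H` is normal, `dP H` is tangential and the inner `P` disappears: `2 - 4 = -2`. With the
  -- minus sign in front of `Pdot`, this is the other half of the coefficient 4.
  have h8 : (2 * ∑ i, dP (R (e i)) * dP (R (e i)) -
      4 * ∑ i, dP (R (e i)) * P * dP (R (e i))) H =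
      - (2 : ℝ) • ∑ i, dP (R (e i)) (dP (R (e i)) H) := by
    have h9 : (∑ i, dP (R (e i)) * P * dP (R (e i))) H = ∑ i, dP (R (e i)) (dP (R (e i)) H) := by
      simp [hPdPH]
    have h10 : (∑ i, dP (R (e i)) * dP (R (e i))) H = ∑ i, dP (R (e i)) (dP (R (e i)) H) := by
      simp
    have h11 : ∀ A B : F →L[ℝ] F, (2 * A - 4 * B) H = (2 : ℝ) • A H - (4 : ℝ) • B H := by
      intro A B
      have h2 : (2 : F →L[ℝ] F) = (2 : ℝ) • 1 := by rw [two_smul, one_add_one_eq_two]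
      have h4 : (4 : F →L[ℝ] F) = (4 : ℝ) • 1 := by
        rw [show (4 : ℝ) = 2 + 2 by norm_num, add_smul, ← h2, ← two_add_two_eq_four]
      rw [h2, h4]; simp
    rw [h11, h9, h10, ← sub_smul]; norm_num
  simp only [add_apply] at h7
  rw [h8] at h7
  simp only [map_add, hN, Finset.sum_add_distrib, J.Q_symm (Rdot _), Finset.sum_neg_distrib, h1, h3]
  simp only [sub_apply, one_apply_eq_self, Finset.sum_sub_distrib, h5, h6, h7]
  module

end ImmersionJet
end Algebra

/-! ### The pseudoinverse: uniqueness, change of coordinates, smoothness and the Gram matrix. -/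

section Pinv

variable {E F V : Type*} [NormedAddCommGroup E] [InnerProductSpace ℝ E] [FiniteDimensional ℝ E]
  [NormedAddCommGroup F] [InnerProductSpace ℝ F] [FiniteDimensional ℝ F]
  [NormedAddCommGroup V] [NormedSpace ℝ V]

open ContinuousLinearMap in
/-- The Moore–Penrose inverse `(L†L)⁻¹L†` of an injective linear map. -/
noncomputable def pinv (L : E →L[ℝ] F) : F →L[ℝ] E :=
  ContinuousLinearMap.inverse (adjoint L ∘L L) ∘L adjoint L

/-- The orthogonal projection onto the range of an injective linear map. -/
noncomputable def rangeProj (L : E →L[ℝ] F) : F →L[ℝ] F := L ∘L pinv L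

theorem isInvertible_adjoint_comp_self {L : E →L[ℝ] F} (hL : Function.Injective L) :
    (ContinuousLinearMap.adjoint L ∘L L).IsInvertible := by
  have h : Function.Injective (ContinuousLinearMap.adjoint L ∘L L : E →L[ℝ] E).toLinearMap := by
    refine (injective_iff_map_eq_zero _).2 fun v hv => ?_
    have h1 : inner ℝ (L v) (L v) = (0 : ℝ) := by
      rw [← ContinuousLinearMap.adjoint_inner_left]
      have : ContinuousLinearMap.adjoint L (L v) = 0 := hv
      rw [this, inner_zero_left]
    exact (injective_iff_map_eq_zero L).1 hL v (inner_self_eq_zero.1 h1)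
  exact ⟨(LinearEquiv.ofInjectiveEndo _ h).toContinuousLinearEquiv, by ext v; rfl⟩

theorem pinv_apply_self {L : E →L[ℝ] F} (hL : Function.Injective L) (v : E) :
    pinv L (L v) = v := by
  have := ContinuousLinearMap.IsInvertible.inverse_comp_self (isInvertible_adjoint_comp_self hL)
  exact congrArg (fun f => f v) this

theorem adjoint_apply_pinv {L : E →L[ℝ] F} (hL : Function.Injective L) (x : F) :
    ContinuousLinearMap.adjoint L (L (pinv L x)) = ContinuousLinearMap.adjoint L x := by
  have := ContinuousLinearMap.IsInvertible.self_comp_inverse (isInvertible_adjoint_comp_self hL)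
  exact congrArg (fun f => f (ContinuousLinearMap.adjoint L x)) this

theorem isSelfAdjoint_rangeProj {L : E →L[ℝ] F} (hL : Function.Injective L) :
    IsSelfAdjoint (rangeProj L) := by
  rw [ContinuousLinearMap.isSelfAdjoint_iff_isSymmetric]
  have key : ∀ x y, inner ℝ (L (pinv L x)) (L (pinv L y)) = inner ℝ (L (pinv L x)) y :=
    fun x y => by
      rw [← ContinuousLinearMap.adjoint_inner_right, adjoint_apply_pinv hL,
        ContinuousLinearMap.adjoint_inner_right]
  intro x y
  change inner ℝ (L (pinv L x)) y = inner ℝ x (L (pinv L y))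
  rw [← key, real_inner_comm, key, real_inner_comm]

/-- Both `L R` and `rangeProj L` are self-adjoint projections onto the range of `L`, hence equal,
and `L` is injective. The criterion does not involve the inner product of `E`, which is why changes
of coordinates are harmless. -/
theorem eq_pinv {L : E →L[ℝ] F} (hL : Function.Injective L) {R : F →L[ℝ] E}
    (h1 : ∀ v, R (L v) = v) (h2 : IsSelfAdjoint (L ∘L R)) : R = pinv L := by
  have h3 : (L ∘L R) * rangeProj L = rangeProj L := by
    ext1 x; change L (R (L (pinv L x))) = L (pinv L x); rw [h1]
  have h4 : rangeProj L * (L ∘L R) = L ∘L R := by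
    ext1 x; change L (pinv L (L (R x))) = L (R x); rw [pinv_apply_self hL]
  have h5 := congrArg star h3
  rw [star_mul, h2.star_eq, (isSelfAdjoint_rangeProj hL).star_eq, h4] at h5
  ext1 x
  exact hL (congrArg (fun f => f x) h5)

theorem pinv_comp_equiv {L : E →L[ℝ] F} (hL : Function.Injective L) {C : E →L[ℝ] E}
    (hC : C.IsInvertible) (x : F) : C (pinv (L ∘L C) x) = pinv L x := by
  obtain ⟨C, rfl⟩ := hC
  have hLC : Function.Injective (L ∘L (C : E →L[ℝ] E)) := hL.comp C.injective
  have : (C.symm : E →L[ℝ] E) ∘L pinv L = pinv (L ∘L (C : E →L[ℝ] E)) := by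
    refine eq_pinv hLC (fun v => ?_) ?_
    · simp [pinv_apply_self hL]
    · convert isSelfAdjoint_rangeProj hL using 1
      ext1 x
      simp [rangeProj]
  rw [← this]; simp

theorem rangeProj_comp_equiv {L : E →L[ℝ] F} (hL : Function.Injective L) {C : E →L[ℝ] E}
    (hC : C.IsInvertible) : rangeProj (L ∘L C) = rangeProj L := by
  ext1 x
  exact congrArg L (pinv_comp_equiv hL hC x)

theorem contDiffAt_pinv {L : E →L[ℝ] F} (hL : Function.Injective L) {n : ℕ∞ω} :
    ContDiffAt ℝ n (pinv : (E →L[ℝ] F) → F →L[ℝ] E) L := by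
  have h1 : ContDiff ℝ n (fun L : E →L[ℝ] F => ContinuousLinearMap.adjoint L) :=
    (ContinuousLinearMap.adjoint (𝕜 := ℝ) (E := E) (F := F)).toContinuousLinearEquiv.contDiff
  have h2 : ContDiffAt ℝ n ContinuousLinearMap.inverse (ContinuousLinearMap.adjoint L ∘L L) :=
    (isInvertible_adjoint_comp_self hL).contDiffAt_map_inverse
  exact (ContDiffAt.comp (f := fun L : E →L[ℝ] F => ContinuousLinearMap.adjoint L ∘L L) L h2
    (h1.clm_comp contDiff_id).contDiffAt).clm_comp h1.contDiffAt

section Coordinates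

variable {m : ℕ}

theorem euclidean_eq_sum (z : EuclideanSpace ℝ (Fin m)) :
    z = ∑ i, z i • EuclideanSpace.single i (1 : ℝ) := by
  ext k; simp [Pi.single_apply]

theorem isUnit_gram {L : EuclideanSpace ℝ (Fin m) →L[ℝ] F} (hL : Function.Injective L) :
    IsUnit (Matrix.of fun i j => inner ℝ (L (EuclideanSpace.single i 1))
      (L (EuclideanSpace.single j (1 : ℝ))) : Matrix (Fin m) (Fin m) ℝ) := by
  rw [← Matrix.mulVec_injective_iff_isUnit]
  refine (injective_iff_map_eq_zero (Matrix.mulVecLin _)).2 fun v hv => ?_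
  obtain ⟨w, hw⟩ : ∃ w : EuclideanSpace ℝ (Fin m),
      w = ∑ j, v j • EuclideanSpace.single j (1 : ℝ) := ⟨_, rfl⟩
  have h0 : ∀ i, inner ℝ (L (EuclideanSpace.single i 1)) (L w) = (0 : ℝ) := fun i => by
    have := congrFun hv i
    simp only [Matrix.mulVecLin_apply, Matrix.mulVec, dotProduct, Matrix.of_apply,
      Pi.zero_apply] at this
    rw [hw, map_sum, inner_sum, ← this]
    refine Finset.sum_congr rfl fun j _ => ?_
    rw [map_smul, inner_smul_right, mul_comm]
  have h1 : inner ℝ (L w) (L w) = (0 : ℝ) := by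
    nth_rewrite 1 [hw]
    rw [map_sum, sum_inner]
    refine Finset.sum_eq_zero fun i _ => ?_
    rw [map_smul, inner_smul_left, h0, mul_zero]
  have h2 : w = 0 := (injective_iff_map_eq_zero L).1 hL w (inner_self_eq_zero.1 h1)
  funext i
  have := congrArg (fun u : EuclideanSpace ℝ (Fin m) => u i) h2
  simpa [hw, Pi.single_apply] using this

/-- The normal equations `L†L z = L†x` in the standard basis have the Gram matrix as coefficients;
this links `pinv` to `g^{ij}`. -/
theorem pinv_eq_sum {L : EuclideanSpace ℝ (Fin m) →L[ℝ] F} (hL : Function.Injective L) (x : F) :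
    pinv L x = ∑ i, ∑ j, ((Matrix.of fun i j => inner ℝ (L (EuclideanSpace.single i 1))
      (L (EuclideanSpace.single j (1 : ℝ))) : Matrix (Fin m) (Fin m) ℝ)⁻¹ i j *
        inner ℝ (L (EuclideanSpace.single j 1)) x) • EuclideanSpace.single i (1 : ℝ) := by
  set g : Matrix (Fin m) (Fin m) ℝ := Matrix.of fun i j => inner ℝ
    (L (EuclideanSpace.single i 1)) (L (EuclideanSpace.single j (1 : ℝ))) with hg
  have hu : IsUnit g.det := (Matrix.isUnit_iff_isUnit_det _).1 (isUnit_gram hL)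
  set z := pinv L x with hz
  have hsum := euclidean_eq_sum z
  have h1 : g.mulVec (fun i => z i) = fun j => inner ℝ (L (EuclideanSpace.single j 1)) x := by
    funext k
    have h2 : inner ℝ (L (EuclideanSpace.single k 1)) (L z) =
        (inner ℝ (L (EuclideanSpace.single k (1 : ℝ))) x : ℝ) := by
      rw [← ContinuousLinearMap.adjoint_inner_right, hz, adjoint_apply_pinv hL,
        ContinuousLinearMap.adjoint_inner_right]
    rw [← h2]
    conv_rhs => rw [hsum]
    rw [map_sum, inner_sum]
    simp only [Matrix.mulVec, dotProduct, hg, Matrix.of_apply]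
    refine Finset.sum_congr rfl fun j _ => ?_
    rw [map_smul, inner_smul_right, mul_comm]
  have h3 : ∀ i, z i = ∑ j, g⁻¹ i j * inner ℝ (L (EuclideanSpace.single j 1)) x := fun i => by
    have : g⁻¹.mulVec (g.mulVec (fun i => z i)) = fun i => z i := by
      rw [Matrix.mulVec_mulVec, Matrix.nonsing_inv_mul _ hu, Matrix.one_mulVec]
    rw [h1] at this
    exact (congrFun this i).symm
  rw [hsum]
  refine Finset.sum_congr rfl fun i _ => ?_
  rw [h3, Finset.sum_smul]

end Coordinates
end Pinv

/-! ### Calculus of a smooth immersion on an open subset of a vector space. -/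

section LocalCalculus

section Rules

variable {E F V : Type*} [NormedAddCommGroup E] [NormedSpace ℝ E]
  [NormedAddCommGroup F] [NormedSpace ℝ F] [NormedAddCommGroup V] [NormedSpace ℝ V]

theorem fderiv_clm_apply_apply {c : E → F →L[ℝ] V} {u : E → F} {y : E}
    (hc : DifferentiableAt ℝ c y) (hu : DifferentiableAt ℝ u y) (v : E) :
    fderiv ℝ (fun y => c y (u y)) y v = c y (fderiv ℝ u y v) + fderiv ℝ c y v (u y) := by
  rw [fderiv_clm_apply hc hu]; simp

theorem fderiv_clm_apply_const {c : E → F →L[ℝ] V} {y : E}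
    (hc : DifferentiableAt ℝ c y) (x : F) (v : E) :
    fderiv ℝ (fun y => c y x) y v = fderiv ℝ c y v x := by
  rw [fderiv_clm_apply_apply hc (differentiableAt_const x)]; simp

theorem fderiv_clm_comp_apply {ℓ : F →L[ℝ] V} {u : E → F} {y : E}
    (hu : DifferentiableAt ℝ u y) (v : E) :
    fderiv ℝ (fun z => ℓ (u z)) y v = ℓ (fderiv ℝ u y v) := by
  have h := (ℓ.hasFDerivAt.comp y hu.hasFDerivAt).fderiv
  exact DFunLike.congr_fun h v

theorem fderiv_congr_on {U : Set E} (hU : IsOpen U) {f g : E → V} (h : ∀ y ∈ U, f y = g y)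
    {y : E} (hy : y ∈ U) : fderiv ℝ f y = fderiv ℝ g y :=
  Filter.EventuallyEq.fderiv_eq (Filter.eventuallyEq_of_mem (hU.mem_nhds hy) h)

theorem ContDiffOn.differentiableAt_of_isOpen {U : Set E} (hU : IsOpen U) {f : E → V}
    (hf : ContDiffOn ℝ ∞ f U) {y : E} (hy : y ∈ U) : DifferentiableAt ℝ f y :=
  (hf.contDiffAt (hU.mem_nhds hy)).differentiableAt (by simp)

theorem ContDiffOn.fderiv_smooth {U : Set E} (hU : IsOpen U) {f : E → V}
    (hf : ContDiffOn ℝ ∞ f U) : ContDiffOn ℝ ∞ (fderiv ℝ f) U :=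
  hf.fderiv_of_isOpen hU (by simp)

theorem two_le_infty : (2 : ℕ∞ω) ≤ ∞ := by
  have : ((2 : ℕ∞) : ℕ∞ω) ≤ ((⊤ : ℕ∞) : ℕ∞ω) := WithTop.coe_le_coe.2 le_top
  exact this

end Rules

variable {E F V ι : Type*} [NormedAddCommGroup E] [InnerProductSpace ℝ E] [FiniteDimensional ℝ E]
  [NormedAddCommGroup F] [InnerProductSpace ℝ F] [FiniteDimensional ℝ F]
  [NormedAddCommGroup V] [NormedSpace ℝ V] [Fintype ι]

/-- `G` is a smooth immersion on the open set `U`. -/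
structure SmoothImmersionOn (G : E → F) (U : Set E) : Prop where
  isOpen : IsOpen U
  contDiffOn : ContDiffOn ℝ ∞ G U
  injective : ∀ y ∈ U, Function.Injective (fderiv ℝ G y)

/-- The pseudoinverse of the differential. -/
noncomputable def dpinv (G : E → F) (y : E) : F →L[ℝ] E := pinv (fderiv ℝ G y)

/-- The projection onto the tangent space of the image. -/
noncomputable def tproj (G : E → F) (y : E) : F →L[ℝ] F := rangeProj (fderiv ℝ G y)

/-- The mean curvature vector of an immersion, as the tangential divergence of the projection. -/
noncomputable def mcv (e : OrthonormalBasis ι ℝ F) (G : E → F) (y : E) : F :=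
  ∑ i, fderiv ℝ (tproj G) y (dpinv G y (e i)) (e i)

/-- The Laplace–Beltrami operator of an immersion. -/
noncomputable def lap (e : OrthonormalBasis ι ℝ F) (G : E → F) (u : E → V) (y : E) : V :=
  ∑ i, fderiv ℝ (fun z => fderiv ℝ u z (dpinv G z (e i))) y (dpinv G y (e i))

namespace SmoothImmersionOn

variable {G : E → F} {U : Set E} (hG : SmoothImmersionOn G U)
include hG

theorem contDiffOn_fderiv : ContDiffOn ℝ ∞ (fderiv ℝ G) U :=
  ContDiffOn.fderiv_smooth hG.isOpen hG.contDiffOn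

theorem contDiffOn_dpinv : ContDiffOn ℝ ∞ (dpinv G) U := fun y hy =>
  (contDiffAt_pinv (hG.injective y hy)).comp_contDiffWithinAt y (hG.contDiffOn_fderiv y hy)

theorem contDiffOn_tproj : ContDiffOn ℝ ∞ (tproj G) U :=
  hG.contDiffOn_fderiv.clm_comp hG.contDiffOn_dpinv

theorem contDiffOn_dtproj : ContDiffOn ℝ ∞ (fderiv ℝ (tproj G)) U :=
  ContDiffOn.fderiv_smooth hG.isOpen hG.contDiffOn_tproj

theorem contDiffOn_mcv (e : OrthonormalBasis ι ℝ F) : ContDiffOn ℝ ∞ (mcv e G) U :=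
  ContDiffOn.sum fun _ _ => (hG.contDiffOn_dtproj.clm_apply
    (hG.contDiffOn_dpinv.clm_apply contDiffOn_const)).clm_apply contDiffOn_const

/-- Every relation is `R L = 1`, `L R = P`, `P L = L`, `P² = P` or `P† = P`, a derivative of one of
these on `U`, or the symmetry of second derivatives. `ddP_L` differentiates the symmetry of the
second fundamental form. -/
theorem jet {y : E} (hy : y ∈ U) :
    ImmersionJet (fderiv ℝ G y) (dpinv G y) (tproj G y) (fderiv ℝ (fderiv ℝ G) y)
      (fderiv ℝ (dpinv G) y) (fderiv ℝ (tproj G) y) (fderiv ℝ (fderiv ℝ (tproj G)) y) := by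
  have hU := hG.isOpen
  have dL : ∀ {y}, y ∈ U → DifferentiableAt ℝ (fderiv ℝ G) y := fun h =>
    ContDiffOn.differentiableAt_of_isOpen hU hG.contDiffOn_fderiv h
  have dR : ∀ {y}, y ∈ U → DifferentiableAt ℝ (dpinv G) y := fun h =>
    ContDiffOn.differentiableAt_of_isOpen hU hG.contDiffOn_dpinv h
  have dP : ∀ {y}, y ∈ U → DifferentiableAt ℝ (tproj G) y := fun h =>
    ContDiffOn.differentiableAt_of_isOpen hU hG.contDiffOn_tproj h
  have ddP : ∀ {y}, y ∈ U → DifferentiableAt ℝ (fderiv ℝ (tproj G)) y := fun h =>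
    ContDiffOn.differentiableAt_of_isOpen hU hG.contDiffOn_dtproj h
  have ddPc : ∀ {y}, y ∈ U → ∀ v, DifferentiableAt ℝ (fun z => fderiv ℝ (tproj G) z v) y :=
    fun h v => (ddP h).clm_apply (differentiableAt_const v)
  have left_inv : ∀ y ∈ U, ∀ v, dpinv G y (fderiv ℝ G y v) = v := fun y hy v =>
    pinv_apply_self (hG.injective y hy) v
  have right_inv : ∀ y, ∀ x, fderiv ℝ G y (dpinv G y x) = tproj G y x := fun y x => rfl
  have sa : ∀ y ∈ U, star (tproj G y) = tproj G y := fun y hy =>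
    isSelfAdjoint_rangeProj (hG.injective y hy)
  have sad : ∀ y ∈ U, ∀ v, star (fderiv ℝ (tproj G) y v) = fderiv ℝ (tproj G) y v :=
    fun y hy v => by
      conv_rhs => rw [← fderiv_congr_on hU sa hy, (dP hy).hasFDerivAt.star.fderiv]
      rfl
  have sadd : ∀ y ∈ U, ∀ v w, star (fderiv ℝ (fderiv ℝ (tproj G)) y v w) =
      fderiv ℝ (fderiv ℝ (tproj G)) y v w := fun y hy v w => by
    rw [← fderiv_clm_apply_const (ddP hy)]
    conv_rhs => rw [← fderiv_congr_on hU (fun y hy => sad y hy w) hy,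
      (ddPc hy w).hasFDerivAt.star.fderiv]
    rfl
  have Qs : ∀ y ∈ U, ∀ v w, fderiv ℝ (fderiv ℝ G) y v w = fderiv ℝ (fderiv ℝ G) y w v :=
    fun y hy v w => (hG.contDiffOn.contDiffAt (hU.mem_nhds hy)).isSymmSndFDerivAt
      (by rw [minSmoothness_of_isRCLikeNormedField]; exact two_le_infty) v w
  have ddPs : ∀ y ∈ U, ∀ v w, fderiv ℝ (fderiv ℝ (tproj G)) y v w =
      fderiv ℝ (fderiv ℝ (tproj G)) y w v :=
    fun y hy v w => (hG.contDiffOn_tproj.contDiffAt (hU.mem_nhds hy)).isSymmSndFDerivAt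
      (by rw [minSmoothness_of_isRCLikeNormedField]; exact two_le_infty) v w
  have PL : ∀ y ∈ U, ∀ v, tproj G y (fderiv ℝ G y v) = fderiv ℝ G y v := fun y hy v => by
    rw [← right_inv, left_inv y hy]
  have dP_L : ∀ y ∈ U, ∀ v w, fderiv ℝ (tproj G) y v (fderiv ℝ G y w)
      + tproj G y (fderiv ℝ (fderiv ℝ G) y v w) = fderiv ℝ (fderiv ℝ G) y v w := fun y hy v w => by
    have h := congrArg (fun f => f v) (fderiv_congr_on hU (fun y hy => PL y hy w) hy)
    rw [fderiv_clm_apply_apply (dP hy) ((dL hy).clm_apply (differentiableAt_const w)),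
      fderiv_clm_apply_const (dL hy), add_comm] at h
    exact h
  have dPLs : ∀ y ∈ U, ∀ v w, fderiv ℝ (tproj G) y v (fderiv ℝ G y w) =
      fderiv ℝ (tproj G) y w (fderiv ℝ G y v) := fun y hy v w => by
    have h1 := dP_L y hy v w
    have h2 := dP_L y hy w v
    rw [Qs y hy w v] at h2
    exact add_right_cancel (h1.trans h2.symm)
  have dPi : ∀ y ∈ U, ∀ v, fderiv ℝ (tproj G) y v * tproj G y + tproj G y * fderiv ℝ (tproj G) y v
      = fderiv ℝ (tproj G) y v := fun y hy v => by
    have h : ∀ y ∈ U, tproj G y * tproj G y = tproj G y := fun y hy => by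
      ext1 x; exact PL y hy _
    have h := congrArg (fun f => f v) (fderiv_congr_on hU h hy)
    rw [fderiv_fun_mul' (dP hy) (dP hy)] at h
    rw [add_comm]
    exact h
  exact
  { left_inv := left_inv y hy
    right_inv := right_inv y
    selfAdjoint := sa y hy
    selfAdjoint_d := sad y hy
    selfAdjoint_dd := sadd y hy
    Q_symm := Qs y hy
    ddP_symm := ddPs y hy
    dP_L := dP_L y hy
    L_dR := fun v x => by
      have h := congrArg (fun f => f v) (fderiv_congr_on hU (fun y _ => right_inv y x) hy)
      rw [fderiv_clm_apply_apply (dL hy) ((dR hy).clm_apply (differentiableAt_const x)),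
        fderiv_clm_apply_const (dR hy), fderiv_clm_apply_const (dP hy), add_comm] at h
      exact h
    dP_idem := dPi y hy
    ddP_idem := fun v w => by
      have h := congrArg (fun f => f v) (fderiv_congr_on hU (fun y hy => dPi y hy w) hy)
      rw [fderiv_fun_add ((ddPc hy w).fun_mul (dP hy)) ((dP hy).fun_mul (ddPc hy w)),
        fderiv_fun_mul' (ddPc hy w) (dP hy), fderiv_fun_mul' (dP hy) (ddPc hy w)] at h
      simp only [add_apply, smul_apply, fderiv_clm_apply_const (ddP hy),
        smul_eq_mul, MulOpposite.smul_eq_mul_unop, MulOpposite.unop_op] at h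
      conv_rhs => rw [← h]
      abel
    ddP_L := fun z v w => by
      have h := congrArg (fun f => f z) (fderiv_congr_on hU (fun y hy => dPLs y hy v w) hy)
      rw [fderiv_clm_apply_apply (ddPc hy v) ((dL hy).clm_apply (differentiableAt_const w)),
        fderiv_clm_apply_apply (ddPc hy w) ((dL hy).clm_apply (differentiableAt_const v)),
        fderiv_clm_apply_const (dL hy), fderiv_clm_apply_const (dL hy),
        fderiv_clm_apply_const (ddP hy), fderiv_clm_apply_const (ddP hy)] at h
      rw [add_comm, h, add_comm] }

variable (e : OrthonormalBasis ι ℝ F)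

theorem lap_eq {u : E → V} (hu : ContDiffOn ℝ ∞ u U) {y : E} (hy : y ∈ U) :
    lap e G u y = ∑ i, fderiv ℝ (fderiv ℝ u) y (dpinv G y (e i)) (dpinv G y (e i))
      + fderiv ℝ u y (∑ i, fderiv ℝ (dpinv G) y (dpinv G y (e i)) (e i)) := by
  have h1 := ContDiffOn.differentiableAt_of_isOpen hG.isOpen
    (ContDiffOn.fderiv_smooth hG.isOpen hu) hy
  have h2 := ContDiffOn.differentiableAt_of_isOpen hG.isOpen hG.contDiffOn_dpinv hy
  rw [map_sum, ← Finset.sum_add_distrib]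
  refine Finset.sum_congr rfl fun i _ => ?_
  rw [fderiv_clm_apply_apply h1 (h2.clm_apply (differentiableAt_const _)),
    fderiv_clm_apply_const h2, add_comm]

theorem fderiv_mcv {y : E} (hy : y ∈ U) (w : E) :
    fderiv ℝ (mcv e G) y w = ∑ i, (fderiv ℝ (fderiv ℝ (tproj G)) y w (dpinv G y (e i)) (e i)
      + fderiv ℝ (tproj G) y (fderiv ℝ (dpinv G) y w (e i)) (e i)) := by
  have h1 := ContDiffOn.differentiableAt_of_isOpen hG.isOpen hG.contDiffOn_dtproj hy
  have h2 := ContDiffOn.differentiableAt_of_isOpen hG.isOpen hG.contDiffOn_dpinv hy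
  have h3 : ∀ i, DifferentiableAt ℝ (fun z => dpinv G z (e i)) y := fun i =>
    h2.clm_apply (differentiableAt_const _)
  have h4 : ∀ i, DifferentiableAt ℝ (fun z => fderiv ℝ (tproj G) z (dpinv G z (e i))) y :=
    fun i => h1.clm_apply (h3 i)
  unfold mcv
  rw [fderiv_fun_sum fun i _ => (h4 i).clm_apply (differentiableAt_const _), sum_apply]
  refine Finset.sum_congr rfl fun i _ => ?_
  rw [fderiv_clm_apply_const (h4 i), fderiv_clm_apply_apply h1 (h3 i), fderiv_clm_apply_const h2,
    add_apply, add_comm]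

theorem tproj_mcv {y : E} (hy : y ∈ U) : tproj G y (mcv e G y) = 0 :=
  (hG.jet hy).P_sum_dP e

theorem tproj_fderiv_mcv {y : E} (hy : y ∈ U) (v : E) :
    tproj G y (fderiv ℝ (mcv e G) y v) + fderiv ℝ (tproj G) y v (mcv e G y) = 0 := by
  have h := congrArg (fun f => f v) (fderiv_congr_on hG.isOpen (fun y hy => hG.tproj_mcv e hy) hy)
  rw [fderiv_clm_apply_apply (ContDiffOn.differentiableAt_of_isOpen hG.isOpen hG.contDiffOn_tproj hy)
    (ContDiffOn.differentiableAt_of_isOpen hG.isOpen (hG.contDiffOn_mcv e) hy)] at h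
  simpa using h

theorem tproj_fderiv_fderiv_mcv {y : E} (hy : y ∈ U) (v w : E) :
    tproj G y (fderiv ℝ (fderiv ℝ (mcv e G)) y v w)
      + fderiv ℝ (tproj G) y v (fderiv ℝ (mcv e G) y w)
      + fderiv ℝ (tproj G) y w (fderiv ℝ (mcv e G) y v)
      + fderiv ℝ (fderiv ℝ (tproj G)) y v w (mcv e G y) = 0 := by
  have h1 := ContDiffOn.differentiableAt_of_isOpen hG.isOpen hG.contDiffOn_tproj hy
  have h2 := ContDiffOn.differentiableAt_of_isOpen hG.isOpen hG.contDiffOn_dtproj hy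
  have h3 := ContDiffOn.differentiableAt_of_isOpen hG.isOpen (hG.contDiffOn_mcv e) hy
  have h4 := ContDiffOn.differentiableAt_of_isOpen hG.isOpen
    (ContDiffOn.fderiv_smooth hG.isOpen (hG.contDiffOn_mcv e)) hy
  have h5 : DifferentiableAt ℝ (fun z => fderiv ℝ (mcv e G) z w) y :=
    h4.clm_apply (differentiableAt_const _)
  have h6 : DifferentiableAt ℝ (fun z => fderiv ℝ (tproj G) z w) y :=
    h2.clm_apply (differentiableAt_const _)
  have h := congrArg (fun f => f v)
    (fderiv_congr_on hG.isOpen (fun y hy => hG.tproj_fderiv_mcv e hy w) hy)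
  rw [fderiv_fun_add (h1.clm_apply h5) (h6.clm_apply h3), add_apply,
    fderiv_clm_apply_apply h1 h5, fderiv_clm_apply_apply h6 h3, fderiv_clm_apply_const h4,
    fderiv_clm_apply_const h2] at h
  rw [← add_assoc] at h
  simpa using h

theorem mcv_eq {y : E} (hy : y ∈ U) :
    mcv e G y = ∑ i, (1 - tproj G y)
      (fderiv ℝ (fderiv ℝ G) y (dpinv G y (e i)) (dpinv G y (e i))) :=
  (hG.jet hy).sum_dP_normal e

end SmoothImmersionOn
end LocalCalculus

/-! ### Manifold derivatives read in a fixed chart. -/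

section Charts

variable {m n : ℕ} {M : Type*} [TopologicalSpace M] [ChartedSpace (EuclideanSpace ℝ (Fin m)) M]
  {V : Type*} [NormedAddCommGroup V] [NormedSpace ℝ V]

local notation "𝔼" => EuclideanSpace ℝ
local notation "φ" => extChartAt (𝓘(ℝ, EuclideanSpace ℝ (Fin m)))

/-- At `q` the manifold derivative refers to the preferred chart at `q`, so comparison with the
chart at `p` leaves a transition factor. -/
theorem mfderiv_of_rep [IsManifold 𝓘(ℝ, EuclideanSpace ℝ (Fin m)) ∞ M] {p q : M}
    (hq : q ∈ (φ p).source) {u : M → V} {f : 𝔼 (Fin m) → V} (h : ∀ q ∈ (φ p).source, u q = f (φ p q))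
    (hf : DifferentiableAt ℝ f (φ p q)) :
    mfderiv 𝓘(ℝ, 𝔼 (Fin m)) 𝓘(ℝ, V) u q =
      (fderiv ℝ f (φ p q)).comp (mfderiv 𝓘(ℝ, 𝔼 (Fin m)) 𝓘(ℝ, 𝔼 (Fin m)) (φ p) q) := by
  have h1 : u =ᶠ[nhds q] f ∘ φ p :=
    Filter.eventuallyEq_of_mem ((isOpen_extChartAt_source p).mem_nhds hq) h
  rw [h1.mfderiv_eq, mfderiv_comp q hf.mdifferentiableAt
    (mdifferentiableAt_extChartAt (by rwa [extChartAt_source] at hq)), mfderiv_eq_fderiv]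
  rfl

/-- At the base point the two charts coincide and no transition factor remains. -/
theorem mfderiv_of_rep_self [IsManifold 𝓘(ℝ, EuclideanSpace ℝ (Fin m)) ∞ M] (p : M)
    {u : M → V} {f : 𝔼 (Fin m) → V} (h : ∀ q ∈ (φ p).source, u q = f (φ p q))
    (hf : DifferentiableAt ℝ f (φ p p)) :
    mfderiv 𝓘(ℝ, 𝔼 (Fin m)) 𝓘(ℝ, V) u p = fderiv ℝ f (φ p p) := by
  have hp := mem_extChartAt_source (I := 𝓘(ℝ, EuclideanSpace ℝ (Fin m))) p
  have h1 : u =ᶠ[nhds p] f ∘ φ p :=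
    Filter.eventuallyEq_of_mem ((isOpen_extChartAt_source p).mem_nhds hp) h
  have h2 : MDifferentiableAt 𝓘(ℝ, 𝔼 (Fin m)) 𝓘(ℝ, V) u p := by
    refine MDifferentiableAt.congr_of_eventuallyEq ?_ h1
    exact hf.mdifferentiableAt.comp p (mdifferentiableAt_extChartAt (mem_chart_source _ p))
  have h3 : ∀ y ∈ (φ p).target, u ((φ p).symm y) = f y := fun y hy => by
    rw [h _ ((φ p).map_target hy), (φ p).right_inv hy]
  have h4 := fderiv_congr_on (isOpen_extChartAt_target (I := 𝓘(ℝ, EuclideanSpace ℝ (Fin m))) p) h3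
    (mem_extChartAt_target p)
  refine h2.mfderiv.trans ?_
  rw [← h4]
  simp [writtenInExtChartAt, Function.comp_def, fderivWithin_univ]
  rfl

end Charts

/-! ### The coordinate definitions in terms of the pseudoinverse. -/

section PointwiseCoordinates

variable {m n : ℕ} {M : Type*} [TopologicalSpace M] [ChartedSpace (EuclideanSpace ℝ (Fin m)) M]
  {V : Type*} [NormedAddCommGroup V] [NormedSpace ℝ V]

theorem partialDeriv_eq {u : M → V} {p : M} {D : EuclideanSpace ℝ (Fin m) →L[ℝ] V}
    (hD : mfderiv 𝓘(ℝ, EuclideanSpace ℝ (Fin m)) 𝓘(ℝ, V) u p = D) (i : Fin m) :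
    partialDeriv u i p = D (EuclideanSpace.single i 1) := by
  rw [partialDeriv, hD]
  rfl

theorem sum_invMetric_smul {F : M → EuclideanSpace ℝ (Fin n)} {p : M}
    {D : EuclideanSpace ℝ (Fin m) →L[ℝ] EuclideanSpace ℝ (Fin n)}
    (hD : mfderiv 𝓘(ℝ, EuclideanSpace ℝ (Fin m)) 𝓘(ℝ, EuclideanSpace ℝ (Fin n)) F p = D)
    (hinj : Function.Injective D) (x : EuclideanSpace ℝ (Fin n)) :
    pinv D x = ∑ i, ∑ j, (invMetric m F p i j * inner ℝ (D (EuclideanSpace.single j 1)) x) •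
        EuclideanSpace.single i (1 : ℝ) := by
  rw [pinv_eq_sum hinj x]
  simp only [invMetric, metric, partialDeriv_eq hD]

theorem inner_single_one_right (x : EuclideanSpace ℝ (Fin n)) (α : Fin n) :
    inner ℝ x (EuclideanSpace.single α (1 : ℝ)) = x α := by
  simp [EuclideanSpace.inner_single_right]

theorem tangentProj_eq {F : M → EuclideanSpace ℝ (Fin n)} {p : M}
    {D : EuclideanSpace ℝ (Fin m) →L[ℝ] EuclideanSpace ℝ (Fin n)}
    (hD : mfderiv 𝓘(ℝ, EuclideanSpace ℝ (Fin m)) 𝓘(ℝ, EuclideanSpace ℝ (Fin n)) F p = D)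
    (hinj : Function.Injective D) (α β : Fin n) :
    tangentProj m F p α β = rangeProj D (EuclideanSpace.single β 1) α := by
  change _ = D (pinv D _) α
  rw [sum_invMetric_smul hD hinj]
  simp only [tangentProj, Matrix.of_apply, map_sum, map_smul, inner_single_one_right, partialDeriv_eq hD,
    WithLp.ofLp_sum, Finset.sum_apply, PiLp.smul_apply, smul_eq_mul]
  refine Finset.sum_congr rfl fun i _ => Finset.sum_congr rfl fun j _ => ?_
  ring

theorem tangGrad_eq {F : M → EuclideanSpace ℝ (Fin n)} {p : M}
    {D : EuclideanSpace ℝ (Fin m) →L[ℝ] EuclideanSpace ℝ (Fin n)}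
    (hD : mfderiv 𝓘(ℝ, EuclideanSpace ℝ (Fin m)) 𝓘(ℝ, EuclideanSpace ℝ (Fin n)) F p = D)
    (hinj : Function.Injective D) {u : M → ℝ} {du : EuclideanSpace ℝ (Fin m) →L[ℝ] ℝ}
    (hu : mfderiv 𝓘(ℝ, EuclideanSpace ℝ (Fin m)) 𝓘(ℝ, ℝ) u p = du) (γ : Fin n) :
    tangGrad m F u p γ = du (pinv D (EuclideanSpace.single γ 1)) := by
  rw [sum_invMetric_smul hD hinj]
  simp only [tangGrad, map_sum, map_smul, inner_single_one_right, partialDeriv_eq hD, partialDeriv_eq hu,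
    WithLp.ofLp_sum, Finset.sum_apply, PiLp.smul_apply, smul_eq_mul]
  refine Finset.sum_congr rfl fun i _ => Finset.sum_congr rfl fun j _ => ?_
  ring

/-- This is `R R† = g⁻¹`: expand the first slot by the Gram formula for `R`, then resum the second
with `R (D e_j) = e_j`. -/
theorem sum_invMetric_bilin {F : M → EuclideanSpace ℝ (Fin n)} {p : M}
    {D : EuclideanSpace ℝ (Fin m) →L[ℝ] EuclideanSpace ℝ (Fin n)}
    (hD : mfderiv 𝓘(ℝ, EuclideanSpace ℝ (Fin m)) 𝓘(ℝ, EuclideanSpace ℝ (Fin n)) F p = D)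
    (hinj : Function.Injective D)
    (b : EuclideanSpace ℝ (Fin m) →L[ℝ] EuclideanSpace ℝ (Fin m) →L[ℝ] V) :
    ∑ i, ∑ j, invMetric m F p i j • b (EuclideanSpace.single i 1) (EuclideanSpace.single j 1) =
      ∑ γ, b (pinv D (EuclideanSpace.single γ 1)) (pinv D (EuclideanSpace.single γ 1)) := by
  have h1 : ∀ γ, b (pinv D (EuclideanSpace.single γ 1)) (pinv D (EuclideanSpace.single γ 1)) =
      ∑ i, ∑ j, invMetric m F p i j • D (EuclideanSpace.single j 1) γ •
        b (EuclideanSpace.single i 1) (pinv D (EuclideanSpace.single γ 1)) := fun γ => by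
    obtain ⟨w, hw⟩ : ∃ w, w = pinv D (EuclideanSpace.single γ 1) := ⟨_, rfl⟩
    rw [← hw]
    have hw' := hw.trans (sum_invMetric_smul hD hinj _)
    conv_lhs => rw [show b w = b (∑ i, ∑ j, (invMetric m F p i j *
      inner ℝ (D (EuclideanSpace.single j 1)) (EuclideanSpace.single γ 1)) •
        EuclideanSpace.single i (1 : ℝ)) from congrArg b hw']
    simp only [map_sum, map_smul, sum_apply, smul_apply, inner_single_one_right, mul_smul]
  simp only [h1]
  rw [Finset.sum_comm (s := (Finset.univ : Finset (Fin n)))]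
  refine Finset.sum_congr rfl fun i _ => ?_
  rw [Finset.sum_comm (s := (Finset.univ : Finset (Fin n)))]
  refine Finset.sum_congr rfl fun j _ => ?_
  rw [← Finset.smul_sum]
  congr 1
  simp only [← map_smul, ← map_sum]
  rw [← euclidean_eq_sum, pinv_apply_self hinj]

theorem normalPart_eq {F : M → EuclideanSpace ℝ (Fin n)} {p : M}
    {D : EuclideanSpace ℝ (Fin m) →L[ℝ] EuclideanSpace ℝ (Fin n)}
    (hD : mfderiv 𝓘(ℝ, EuclideanSpace ℝ (Fin m)) 𝓘(ℝ, EuclideanSpace ℝ (Fin n)) F p = D)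
    (hinj : Function.Injective D) (w : EuclideanSpace ℝ (Fin n)) :
    normalPart m F p w = (1 - rangeProj D) w := by
  change w - _ = w - _
  congr 1
  ext α
  conv_rhs => rw [euclidean_eq_sum w]
  simp only [Matrix.toLpLin_apply, Matrix.mulVec, dotProduct, map_sum, map_smul,
    WithLp.ofLp_sum, Finset.sum_apply, PiLp.smul_apply, smul_eq_mul, tangentProj_eq hD hinj]
  refine Finset.sum_congr rfl fun β _ => mul_comm _ _

end PointwiseCoordinates

/-! ### Geometric quantities near a point, in the one chart at that point. -/

section Representatives

variable {m n : ℕ} {M : Type*} [TopologicalSpace M] [ChartedSpace (EuclideanSpace ℝ (Fin m)) M]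
  {V : Type*} [NormedAddCommGroup V] [NormedSpace ℝ V]

local notation "𝔼" => EuclideanSpace ℝ
local notation "φ" => extChartAt (𝓘(ℝ, EuclideanSpace ℝ (Fin m)))

/-- `f` is the smooth representative of `u` in the preferred chart at `p`. -/
structure IsRepAt (p : M) (u : M → V) (f : 𝔼 (Fin m) → V) : Prop where
  eq : ∀ q ∈ (φ p).source, u q = f (φ p q)
  smooth : ContDiffOn ℝ ∞ f (φ p).target

/-- The representative of a map in the preferred chart at `p`. -/
noncomputable def rep (m : ℕ) {M : Type*} [TopologicalSpace M]
    [ChartedSpace (EuclideanSpace ℝ (Fin m)) M] (F : M → V) (p : M) : 𝔼 (Fin m) → V :=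
  F ∘ (extChartAt 𝓘(ℝ, EuclideanSpace ℝ (Fin m)) p).symm

/-- `F` is a smooth immersion of the manifold `M`. -/
structure IsImmersion (m : ℕ) {M : Type*} [TopologicalSpace M]
    [ChartedSpace (EuclideanSpace ℝ (Fin m)) M] (F : M → 𝔼 (Fin n)) : Prop where
  smooth : ContMDiff 𝓘(ℝ, 𝔼 (Fin m)) 𝓘(ℝ, 𝔼 (Fin n)) ∞ F
  injective : ∀ q, Function.Injective (mfderiv 𝓘(ℝ, 𝔼 (Fin m)) 𝓘(ℝ, 𝔼 (Fin n)) F q)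

/-- The standard basis of Euclidean space. -/
noncomputable abbrev stdBasis (n : ℕ) : OrthonormalBasis (Fin n) ℝ (𝔼 (Fin n)) :=
  EuclideanSpace.basisFun (Fin n) ℝ

theorem isOpen_target (p : M) : IsOpen (φ p).target := isOpen_extChartAt_target p

namespace IsRepAt

variable {p : M} {u : M → V} {f : 𝔼 (Fin m) → V} (h : IsRepAt p u f)
include h

theorem differentiableAt {q : M} (hq : q ∈ (φ p).source) : DifferentiableAt ℝ f (φ p q) :=
  ContDiffOn.differentiableAt_of_isOpen (isOpen_target p) h.smooth ((φ p).map_source hq)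

variable [IsManifold 𝓘(ℝ, EuclideanSpace ℝ (Fin m)) ∞ M]

theorem mfderiv_eq {q : M} (hq : q ∈ (φ p).source) :
    ∃ C : 𝔼 (Fin m) →L[ℝ] 𝔼 (Fin m), C.IsInvertible ∧
      C = mfderiv 𝓘(ℝ, 𝔼 (Fin m)) 𝓘(ℝ, 𝔼 (Fin m)) (φ p) q ∧
      mfderiv 𝓘(ℝ, 𝔼 (Fin m)) 𝓘(ℝ, V) u q = fderiv ℝ f (φ p q) ∘L C :=
  ⟨mfderiv 𝓘(ℝ, 𝔼 (Fin m)) 𝓘(ℝ, 𝔼 (Fin m)) (φ p) q, isInvertible_mfderiv_extChartAt hq, rfl,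
    mfderiv_of_rep hq h.eq (h.differentiableAt hq)⟩

end IsRepAt

variable [IsManifold 𝓘(ℝ, EuclideanSpace ℝ (Fin m)) ∞ M]

theorem isRepAt_rep {F : M → V} (hF : ContMDiff 𝓘(ℝ, 𝔼 (Fin m)) 𝓘(ℝ, V) ∞ F) (p : M) :
    IsRepAt p F (rep m F p) where
  eq q hq := by rw [rep, Function.comp_apply, (φ p).left_inv hq]
  smooth := contMDiffOn_iff_contDiffOn.1
    (hF.comp_contMDiffOn (contMDiffOn_extChartAt_symm p))

namespace IsImmersion

variable {F : M → 𝔼 (Fin n)} (hF : IsImmersion m F)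
include hF

theorem isRepAt (p : M) : IsRepAt p F (rep m F p) := isRepAt_rep hF.smooth p

theorem injective_fderiv_rep {p q : M} (hq : q ∈ (φ p).source) :
    Function.Injective (fderiv ℝ (rep m F p) (φ p q)) := by
  obtain ⟨C, ⟨C, rfl⟩, -, h2⟩ := (hF.isRepAt p).mfderiv_eq hq
  have h3 : Function.Injective (fderiv ℝ (rep m F p) (φ p q) ∘L (C : 𝔼 (Fin m) →L[ℝ] 𝔼 (Fin m))) := by
    rw [← h2]; exact hF.injective q
  intro v w hvw
  have := @h3 (C.symm v) (C.symm w) (by simpa using hvw)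
  exact C.symm.injective this

theorem smoothImmersionOn (p : M) : SmoothImmersionOn (rep m F p) (φ p).target where
  isOpen := isOpen_target p
  contDiffOn := (hF.isRepAt p).smooth
  injective y hy := by
    have := hF.injective_fderiv_rep ((φ p).map_target hy)
    rwa [(φ p).right_inv hy] at this

theorem tangentProj_eq_tproj {p q : M} (hq : q ∈ (φ p).source) (α β : Fin n) :
    tangentProj m F q α β = tproj (rep m F p) (φ p q) (stdBasis n β) α := by
  obtain ⟨C, hC, -, h2⟩ := (hF.isRepAt p).mfderiv_eq hq
  have hi := hF.injective_fderiv_rep hq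
  have hinj : Function.Injective (fderiv ℝ (rep m F p) (φ p q) ∘L C) := by
    rw [← h2]; exact hF.injective q
  rw [tangentProj_eq h2 hinj, rangeProj_comp_equiv hi hC]
  simp [tproj]

theorem tangGrad_eq_fderiv {p q : M} (hq : q ∈ (φ p).source) {u : M → ℝ} {f : 𝔼 (Fin m) → ℝ}
    (hu : IsRepAt p u f) (γ : Fin n) :
    tangGrad m F u q γ = fderiv ℝ f (φ p q) (dpinv (rep m F p) (φ p q) (stdBasis n γ)) := by
  obtain ⟨C, hC, h1, h2⟩ := (hF.isRepAt p).mfderiv_eq hq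
  obtain ⟨C', -, h1', h2'⟩ := hu.mfderiv_eq hq
  obtain rfl : C = C' := h1.trans h1'.symm
  have hi := hF.injective_fderiv_rep hq
  have hinj : Function.Injective (fderiv ℝ (rep m F p) (φ p q) ∘L C) := by
    rw [← h2]; exact hF.injective q
  rw [tangGrad_eq h2 hinj h2', ContinuousLinearMap.comp_apply, pinv_comp_equiv hi hC]
  simp [dpinv]

/-- Having a smooth representative passes to the gradient, so the gradient can be iterated to reach
the Laplacian. -/
theorem isRepAt_tangGrad {p : M} {u : M → ℝ} {f : 𝔼 (Fin m) → ℝ} (hu : IsRepAt p u f) (γ : Fin n) :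
    IsRepAt p (fun q => tangGrad m F u q γ)
      (fun y => fderiv ℝ f y (dpinv (rep m F p) y (stdBasis n γ))) where
  eq _ hq := hF.tangGrad_eq_fderiv hq hu γ
  smooth := (ContDiffOn.fderiv_smooth (isOpen_target p) hu.smooth).clm_apply
    ((hF.smoothImmersionOn p).contDiffOn_dpinv.clm_apply contDiffOn_const)

theorem laplaceBeltrami_eq_lap (p : M) {u : M → ℝ} {f : 𝔼 (Fin m) → ℝ} (hu : IsRepAt p u f) :
    laplaceBeltrami m F u p = lap (stdBasis n) (rep m F p) f (φ p p) := by
  unfold laplaceBeltrami tangDiv lap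
  exact Finset.sum_congr rfl fun γ _ =>
    hF.tangGrad_eq_fderiv (mem_extChartAt_source p) (hF.isRepAt_tangGrad hu γ) γ

theorem isRepAt_tangentProj (p : M) (α β : Fin n) :
    IsRepAt p (fun q => tangentProj m F q α β)
      (fun y => tproj (rep m F p) y (stdBasis n β) α) where
  eq _ hq := hF.tangentProj_eq_tproj hq α β
  smooth := (EuclideanSpace.proj α : 𝔼 (Fin n) →L[ℝ] ℝ).contDiff.comp_contDiffOn
    ((hF.smoothImmersionOn p).contDiffOn_tproj.clm_apply contDiffOn_const)

theorem fderiv_entry {p : M} {y : 𝔼 (Fin m)} (hy : y ∈ (φ p).target) (α β : Fin n)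
    (v : 𝔼 (Fin m)) :
    fderiv ℝ (fun y => tproj (rep m F p) y (stdBasis n β) α) y v =
      fderiv ℝ (tproj (rep m F p)) y v (stdBasis n β) α := by
  have h1 := ContDiffOn.differentiableAt_of_isOpen (isOpen_target p)
    (hF.smoothImmersionOn p).contDiffOn_tproj hy
  rw [← fderiv_clm_apply_const h1]
  exact fderiv_clm_comp_apply (ℓ := (EuclideanSpace.proj α : 𝔼 (Fin n) →L[ℝ] ℝ))
    (h1.clm_apply (differentiableAt_const (stdBasis n β))) v

/-- The right side does not mention the chart at `p`, so the divergence formula for the mean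
curvature is independent of the chart. -/
theorem mcv_eq_tangDiv {p q : M} (hq : q ∈ (φ p).source) (α : Fin n) :
    mcv (stdBasis n) (rep m F p) (φ p q) α =
      ∑ γ, tangGrad m F (fun q => tangentProj m F q α γ) q γ := by
  simp only [mcv, WithLp.ofLp_sum, Finset.sum_apply]
  refine Finset.sum_congr rfl fun γ _ => ?_
  rw [hF.tangGrad_eq_fderiv hq (hF.isRepAt_tangentProj p α γ), hF.fderiv_entry ((φ p).map_source hq)]

theorem mfderiv_self (p : M) :
    mfderiv 𝓘(ℝ, 𝔼 (Fin m)) 𝓘(ℝ, 𝔼 (Fin n)) F p = fderiv ℝ (rep m F p) (φ p p) :=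
  mfderiv_of_rep_self p (hF.isRepAt p).eq ((hF.isRepAt p).differentiableAt (mem_extChartAt_source p))

theorem meanCurv_eq_sum (p : M) :
    meanCurv m F p = ∑ γ, (1 - tproj (rep m F p) (φ p p)) (fderiv ℝ (fderiv ℝ (rep m F p)) (φ p p)
      (dpinv (rep m F p) (φ p p) (stdBasis n γ)) (dpinv (rep m F p) (φ p p) (stdBasis n γ))) := by
  have hp := mem_extChartAt_source (I := 𝓘(ℝ, EuclideanSpace ℝ (Fin m))) p
  have hD := hF.mfderiv_self p
  have hi := hF.injective_fderiv_rep hp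
  have h1 := ContDiffOn.differentiableAt_of_isOpen (isOpen_target p)
    (hF.smoothImmersionOn p).contDiffOn_fderiv ((φ p).map_source hp)
  have h2 : ∀ i j, secondFundForm m F i j p = (1 - tproj (rep m F p) (φ p p))
      (fderiv ℝ (fderiv ℝ (rep m F p)) (φ p p) (EuclideanSpace.single i 1)
        (EuclideanSpace.single j 1)) := fun i j => by
    rw [secondFundForm, normalPart_eq hD hi]
    congr 1
    exact fderiv_clm_apply_const h1 _ _
  have h3 := sum_invMetric_bilin hD hi (fderiv ℝ (fderiv ℝ (rep m F p)) (φ p p))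
  have h4 : meanCurv m F p = (1 - tproj (rep m F p) (φ p p)) (∑ i, ∑ j, invMetric m F p i j •
      fderiv ℝ (fderiv ℝ (rep m F p)) (φ p p) (EuclideanSpace.single i 1)
        (EuclideanSpace.single j 1)) := by
    rw [map_sum]
    refine Finset.sum_congr rfl fun i _ => ?_
    rw [map_sum]
    refine Finset.sum_congr rfl fun j _ => ?_
    rw [map_smul, h2]
  rw [h4, h3, map_sum]
  simp [dpinv]

/-- The definition takes second derivatives in the chart at `q`. Passing through the divergence of
the projection moves to the chart at `p` without a transformation law for second derivatives. -/
theorem meanCurv_eq_mcv {p q : M} (hq : q ∈ (φ p).source) :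
    meanCurv m F q = mcv (stdBasis n) (rep m F p) (φ p q) := by
  have h1 : meanCurv m F q = mcv (stdBasis n) (rep m F q) (φ q q) := by
    rw [hF.meanCurv_eq_sum q, (hF.smoothImmersionOn q).mcv_eq _ (mem_extChartAt_target q)]
  ext α
  rw [h1, hF.mcv_eq_tangDiv (mem_extChartAt_source q), hF.mcv_eq_tangDiv hq]

end IsImmersion
end Representatives

/-! ### Differentiation on a closed time interval times an open set. -/

section TimeCalculus

variable {E V : Type*} [NormedAddCommGroup E] [NormedSpace ℝ E]
  [NormedAddCommGroup V] [NormedSpace ℝ V] {T : ℝ} {U : Set E} {f : ℝ → E → V}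

theorem uniqueDiffOn_slab (hT : 0 < T) (hU : IsOpen U) : UniqueDiffOn ℝ (Icc 0 T ×ˢ U) :=
  (uniqueDiffOn_Icc hT).prod hU.uniqueDiffOn

theorem fderiv_eq_comp_inr (hU : IsOpen U)
    (hf : ContDiffOn ℝ ∞ (fun z : ℝ × E => f z.1 z.2) (Icc 0 T ×ˢ U)) {t : ℝ} (ht : t ∈ Icc 0 T)
    {y : E} (hy : y ∈ U) : fderiv ℝ (f t) y =
      fderivWithin ℝ (fun z : ℝ × E => f z.1 z.2) (Icc 0 T ×ˢ U) (t, y) ∘L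
        ContinuousLinearMap.inr ℝ ℝ E := by
  have h1 := (hf.differentiableOn (by simp) (t, y) ⟨ht, hy⟩).hasFDerivWithinAt
  have h2 : HasFDerivWithinAt (fun y : E => ((t, y) : ℝ × E)) (ContinuousLinearMap.inr ℝ ℝ E) U y :=
    (hasFDerivAt_prodMk_right t y).hasFDerivWithinAt
  have h3 := HasFDerivWithinAt.comp (t := Icc 0 T ×ˢ U) y h1 h2 (fun z hz => ⟨ht, hz⟩)
  exact (h3.hasFDerivAt (hU.mem_nhds hy)).fderiv

theorem hasDerivWithinAt_slab
    (hf : ContDiffOn ℝ ∞ (fun z : ℝ × E => f z.1 z.2) (Icc 0 T ×ˢ U)) {t : ℝ} (ht : t ∈ Icc 0 T)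
    {y : E} (hy : y ∈ U) : HasDerivWithinAt (fun s => f s y)
      (fderivWithin ℝ (fun z : ℝ × E => f z.1 z.2) (Icc 0 T ×ˢ U) (t, y) (1, 0)) (Icc 0 T) t := by
  have h1 := (hf.differentiableOn (by simp) (t, y) ⟨ht, hy⟩).hasFDerivWithinAt
  have h2 : HasDerivWithinAt (fun s : ℝ => ((s, y) : ℝ × E)) (1, 0) (Icc 0 T) t :=
    ((hasDerivAt_id t).prodMk (hasDerivAt_const t y)).hasDerivWithinAt
  exact HasFDerivWithinAt.comp_hasDerivWithinAt (t := Icc 0 T ×ˢ U) t h1 h2 (fun z hz => ⟨hz, hy⟩)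

theorem contDiffOn_fderivWithin_slab (hT : 0 < T) (hU : IsOpen U)
    (hf : ContDiffOn ℝ ∞ (fun z : ℝ × E => f z.1 z.2) (Icc 0 T ×ˢ U)) :
    ContDiffOn ℝ ∞ (fderivWithin ℝ (fun z : ℝ × E => f z.1 z.2) (Icc 0 T ×ˢ U))
      (Icc 0 T ×ˢ U) :=
  hf.fderivWithin (uniqueDiffOn_slab hT hU) (by simp)

theorem contDiffOn_fderiv_slab (hT : 0 < T) (hU : IsOpen U)
    (hf : ContDiffOn ℝ ∞ (fun z : ℝ × E => f z.1 z.2) (Icc 0 T ×ˢ U)) :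
    ContDiffOn ℝ ∞ (fun z : ℝ × E => fderiv ℝ (f z.1) z.2) (Icc 0 T ×ˢ U) :=
  ((contDiffOn_fderivWithin_slab hT hU hf).clm_comp contDiffOn_const).congr
    fun _ hz => fderiv_eq_comp_inr hU hf hz.1 hz.2

/-- Time and space derivatives commute, up to the end points of the time interval. -/
theorem hasDerivWithinAt_fderiv (hT : 0 < T) (hU : IsOpen U)
    (hf : ContDiffOn ℝ ∞ (fun z : ℝ × E => f z.1 z.2) (Icc 0 T ×ˢ U)) {t : ℝ} (ht : t ∈ Icc 0 T)
    {g : E → V} (hg : ∀ y ∈ U, HasDerivWithinAt (fun s => f s y) (g y) (Icc 0 T) t)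
    {y : E} (hy : y ∈ U) :
    HasDerivWithinAt (fun s => fderiv ℝ (f s) y) (fderiv ℝ g y) (Icc 0 T) t := by
  set S := Icc 0 T ×ˢ U
  set K := fderivWithin ℝ (fun z : ℝ × E => f z.1 z.2) S with hK
  have hKs : ContDiffOn ℝ ∞ K S := contDiffOn_fderivWithin_slab hT hU hf
  have hu := uniqueDiffOn_Icc hT t ht
  have hg' : ∀ z ∈ U, g z = K (t, z) (1, 0) := fun z hz =>
    hu.eq_deriv _ (hg z hz) (hasDerivWithinAt_slab hf ht hz)
  have hKd := (hKs.differentiableOn (by simp) (t, y) ⟨ht, hy⟩).hasFDerivWithinAt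
  have h1 := hasDerivWithinAt_slab (f := fun s z => K (s, z)) hKs ht hy
  have h2 : HasDerivWithinAt (fun s => K (s, y) ∘L ContinuousLinearMap.inr ℝ ℝ E)
      (fderivWithin ℝ K S (t, y) (1, 0) ∘L ContinuousLinearMap.inr ℝ ℝ E) (Icc 0 T) t := by
    have := h1.clm_comp (hasDerivWithinAt_const t (Icc 0 T) (ContinuousLinearMap.inr ℝ ℝ E))
    simpa using this
  have h3 : fderiv ℝ g y = fderivWithin ℝ K S (t, y) (1, 0) ∘L ContinuousLinearMap.inr ℝ ℝ E := by
    rw [fderiv_congr_on hU hg' hy]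
    have h4 := fderiv_eq_comp_inr (f := fun s z => K (s, z)) hU hKs ht hy
    have h5 : DifferentiableAt ℝ (fun z => K (t, z)) y :=
      ContDiffOn.differentiableAt_of_isOpen hU
        (hKs.comp (contDiffOn_const.prodMk contDiffOn_id) fun z hz => ⟨ht, hz⟩) hy
    ext v
    rw [fderiv_clm_apply_const h5, h4]
    -- Symmetry within a set needs the point to lie in the closure of the interior; as `0 < T`, this
    -- includes the end points of the interval.
    have hsymm : IsSymmSndFDerivWithinAt ℝ (fun z : ℝ × E => f z.1 z.2) S (t, y) := by
      refine (hf (t, y) ⟨ht, hy⟩).isSymmSndFDerivWithinAt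
        (by rw [minSmoothness_of_isRCLikeNormedField]; exact two_le_infty)
        (uniqueDiffOn_slab hT hU) ?_ ⟨ht, hy⟩
      rw [interior_prod_eq, interior_Icc, hU.interior_eq, closure_prod_eq, closure_Ioo hT.ne]
      exact ⟨ht, subset_closure hy⟩
    exact hsymm (0, v) (1, 0)
  rw [h3]
  exact h2.congr (fun s hs => fderiv_eq_comp_inr hU hf hs hy) (fderiv_eq_comp_inr hU hf ht hy)

end TimeCalculus

/-! ### The flow in a fixed chart. -/

section Flow

variable {m n : ℕ} {M : Type*} [TopologicalSpace M] [ChartedSpace (EuclideanSpace ℝ (Fin m)) M]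
  [IsManifold 𝓘(ℝ, EuclideanSpace ℝ (Fin m)) ∞ M] {T : ℝ}
  {X : ℝ → M → EuclideanSpace ℝ (Fin n)}

local notation "𝔼" => EuclideanSpace ℝ
local notation "φ" => extChartAt (𝓘(ℝ, EuclideanSpace ℝ (Fin m)))

namespace IsMeanCurvatureFlow

variable (hX : IsMeanCurvatureFlow m T X)
include hX

theorem isImmersion {t : ℝ} (ht : t ∈ Icc 0 T) : IsImmersion m (X t) where
  smooth := by
    rw [← contMDiffOn_univ]
    exact hX.smooth.comp (contMDiffOn_const.prodMk contMDiffOn_id) fun q _ => ⟨ht, mem_univ _⟩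
  injective := hX.immersion t ht

theorem contDiffOn_rep (p : M) : ContDiffOn ℝ ∞ (fun z : ℝ × 𝔼 (Fin m) => rep m (X z.1) p z.2)
    (Icc 0 T ×ˢ (φ p).target) := by
  have h1 : ContMDiffOn (𝓘(ℝ, ℝ).prod 𝓘(ℝ, 𝔼 (Fin m))) (𝓘(ℝ, ℝ).prod 𝓘(ℝ, 𝔼 (Fin m))) ∞
      (fun z : ℝ × 𝔼 (Fin m) => (z.1, (φ p).symm z.2)) (Icc 0 T ×ˢ (φ p).target) :=
    contMDiffOn_fst.prodMk ((contMDiffOn_extChartAt_symm p).comp contMDiffOn_snd fun z hz => hz.2)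
  have h2 := hX.smooth.comp h1 fun z hz => ⟨hz.1, mem_univ _⟩
  rw [← contMDiffOn_iff_contDiffOn, modelWithCornersSelf_prod, ← chartedSpaceSelf_prod]
  exact h2

/-- With the velocity known on the whole chart domain, `H` can be differentiated in space, which
yields the time derivative `dH` of `L`. -/
theorem velocity_rep {t : ℝ} (ht : t ∈ Icc 0 T) (p : M) {y : 𝔼 (Fin m)} (hy : y ∈ (φ p).target) :
    HasDerivWithinAt (fun s => rep m (X s) p y) (mcv (stdBasis n) (rep m (X t) p) y)
      (Icc 0 T) t := by
  have := hX.velocity t ht ((φ p).symm y)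
  rwa [(hX.isImmersion ht).meanCurv_eq_mcv ((φ p).map_target hy), (φ p).right_inv hy] at this

end IsMeanCurvatureFlow

end Flow

/-! ### Matrix entries, the nonlinearities, and the evolution equations along the flow. -/

section Evolution

variable {m n : ℕ} {M : Type*} [TopologicalSpace M] [ChartedSpace (EuclideanSpace ℝ (Fin m)) M]
  [IsManifold 𝓘(ℝ, EuclideanSpace ℝ (Fin m)) ∞ M] {T : ℝ}
  {X : ℝ → M → EuclideanSpace ℝ (Fin n)}

local notation "𝔼" => EuclideanSpace ℝ
local notation "φ" => extChartAt (𝓘(ℝ, EuclideanSpace ℝ (Fin m)))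

theorem SmoothImmersionOn.lap_clm_comp {E F V ι : Type*} [NormedAddCommGroup E]
    [InnerProductSpace ℝ E] [FiniteDimensional ℝ E] [NormedAddCommGroup F] [InnerProductSpace ℝ F]
    [FiniteDimensional ℝ F] [NormedAddCommGroup V] [NormedSpace ℝ V] [Fintype ι]
    {G : E → F} {U : Set E} (hG : SmoothImmersionOn G U) (e : OrthonormalBasis ι ℝ F)
    (ℓ : V →L[ℝ] ℝ) {u : E → V} (hu : ContDiffOn ℝ ∞ u U) {y : E} (hy : y ∈ U) :
    lap e G (fun z => ℓ (u z)) y = ℓ (lap e G u y) := by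
  have h2 := ContDiffOn.fderiv_smooth hG.isOpen hu
  unfold lap
  rw [map_sum]
  refine Finset.sum_congr rfl fun i _ => ?_
  have h3 : ∀ z ∈ U, fderiv ℝ (fun z => ℓ (u z)) z (dpinv G z (e i)) =
      ℓ (fderiv ℝ u z (dpinv G z (e i))) := fun z hz =>
    fderiv_clm_comp_apply (ContDiffOn.differentiableAt_of_isOpen hG.isOpen hu hz) _
  rw [fderiv_congr_on hG.isOpen h3 hy]
  exact fderiv_clm_comp_apply (ContDiffOn.differentiableAt_of_isOpen hG.isOpen
    (h2.clm_apply (hG.contDiffOn_dpinv.clm_apply contDiffOn_const)) hy) _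

/-- The linear functional reading off a matrix entry. -/
noncomputable def entry (α β : Fin n) : (𝔼 (Fin n) →L[ℝ] 𝔼 (Fin n)) →L[ℝ] ℝ :=
  (EuclideanSpace.proj α : 𝔼 (Fin n) →L[ℝ] ℝ) ∘L ContinuousLinearMap.apply ℝ _ (stdBasis n β)

theorem entry_apply (α β : Fin n) (A : 𝔼 (Fin n) →L[ℝ] 𝔼 (Fin n)) :
    entry α β A = A (stdBasis n β) α := rfl

theorem apply_eq_sum_entry (A : 𝔼 (Fin n) →L[ℝ] 𝔼 (Fin n)) (x : 𝔼 (Fin n)) (α : Fin n) :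
    A x α = ∑ μ, entry α μ A * x μ := by
  conv_lhs => rw [euclidean_eq_sum x]
  simp [entry_apply, mul_comm]

theorem entry_symm {A : 𝔼 (Fin n) →L[ℝ] 𝔼 (Fin n)} (hA : IsSelfAdjoint A) (α β : Fin n) :
    entry α β A = entry β α A := by
  have h := ContinuousLinearMap.isSelfAdjoint_iff_isSymmetric.1 hA (stdBasis n α) (stdBasis n β)
  simp only [ContinuousLinearMap.coe_coe, EuclideanSpace.basisFun_apply,
    EuclideanSpace.inner_single_left, inner_single_one_right] at h
  simpa [entry_apply] using h.symm

theorem sum_rotate (f : Fin n → Fin n → Fin n → ℝ) :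
    ∑ i, ∑ j, ∑ k, f i j k = ∑ k, ∑ j, ∑ i, f i j k := by
  rw [Finset.sum_comm]
  simp only [Finset.sum_comm (f := fun i k => f i _ k)]
  rw [Finset.sum_comm]

theorem inner_eq_sum (x y : 𝔼 (Fin n)) : inner ℝ x y = ∑ γ, x γ * y γ := by
  rw [PiLp.inner_apply]
  exact Finset.sum_congr rfl fun γ _ => by simp [mul_comm]

namespace IsImmersion

variable {F : M → 𝔼 (Fin n)} (hF : IsImmersion m F) (p : M)
include hF

theorem tangGrad_tangentProj (α β γ : Fin n) :
    tangGrad m F (fun q => tangentProj m F q α β) p γ =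
      entry α β (fderiv ℝ (tproj (rep m F p)) (φ p p)
        (dpinv (rep m F p) (φ p p) (stdBasis n γ))) := by
  rw [hF.tangGrad_eq_fderiv (mem_extChartAt_source p) (hF.isRepAt_tangentProj p α β),
    hF.fderiv_entry (mem_extChartAt_target p)]
  rfl

theorem isRepAt_meanCurv_apply (α : Fin n) :
    IsRepAt p (fun q => meanCurv m F q α) (fun y => mcv (stdBasis n) (rep m F p) y α) where
  eq q hq := by rw [hF.meanCurv_eq_mcv hq]
  smooth := (EuclideanSpace.proj α : 𝔼 (Fin n) →L[ℝ] ℝ).contDiff.comp_contDiffOn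
    ((hF.smoothImmersionOn p).contDiffOn_mcv _)

theorem tangGrad_meanCurv (α γ : Fin n) :
    tangGrad m F (fun q => meanCurv m F q α) p γ =
      fderiv ℝ (mcv (stdBasis n) (rep m F p)) (φ p p)
        (dpinv (rep m F p) (φ p p) (stdBasis n γ)) α := by
  rw [hF.tangGrad_eq_fderiv (mem_extChartAt_source p) (hF.isRepAt_meanCurv_apply p α)]
  exact fderiv_clm_comp_apply (ℓ := (EuclideanSpace.proj α : 𝔼 (Fin n) →L[ℝ] ℝ))
    (ContDiffOn.differentiableAt_of_isOpen (isOpen_target p)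
      ((hF.smoothImmersionOn p).contDiffOn_mcv (stdBasis n)) (mem_extChartAt_target p)) _

theorem laplaceBeltrami_tangentProj (α β : Fin n) :
    laplaceBeltrami m F (fun q => tangentProj m F q α β) p =
      entry α β (lap (stdBasis n) (rep m F p) (tproj (rep m F p)) (φ p p)) := by
  rw [hF.laplaceBeltrami_eq_lap p (hF.isRepAt_tangentProj p α β),
    ← (hF.smoothImmersionOn p).lap_clm_comp _ _ (hF.smoothImmersionOn p).contDiffOn_tproj
      (mem_extChartAt_target p)]
  rfl

theorem laplaceBeltrami_meanCurv (α : Fin n) :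
    laplaceBeltrami m F (fun q => meanCurv m F q α) p =
      lap (stdBasis n) (rep m F p) (mcv (stdBasis n) (rep m F p)) (φ p p) α := by
  rw [hF.laplaceBeltrami_eq_lap p (hF.isRepAt_meanCurv_apply p α)]
  exact (hF.smoothImmersionOn p).lap_clm_comp _ (EuclideanSpace.proj α : 𝔼 (Fin n) →L[ℝ] ℝ)
    ((hF.smoothImmersionOn p).contDiffOn_mcv _) (mem_extChartAt_target p)

/-- The derivatives of the projection are symmetric matrices, so the contractions over second
indices in `f₁` are matrix products. -/
theorem f₁_eq (α β : Fin n) :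
    f₁ m F (tangentProj m F) p α β = entry α β
      (2 * ∑ γ, fderiv ℝ (tproj (rep m F p)) (φ p p) (dpinv (rep m F p) (φ p p) (stdBasis n γ))
          * fderiv ℝ (tproj (rep m F p)) (φ p p) (dpinv (rep m F p) (φ p p) (stdBasis n γ))
        - 4 * ∑ γ, fderiv ℝ (tproj (rep m F p)) (φ p p) (dpinv (rep m F p) (φ p p) (stdBasis n γ))
          * tproj (rep m F p) (φ p p)
          * fderiv ℝ (tproj (rep m F p)) (φ p p)
              (dpinv (rep m F p) (φ p p) (stdBasis n γ))) := by
  have J := (hF.smoothImmersionOn p).jet (mem_extChartAt_target p)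
  simp only [f₁, Matrix.of_apply, inner_eq_sum, hF.tangGrad_tangentProj]
  have hP : ∀ μ κ, tangentProj m F p μ κ = entry μ κ (tproj (rep m F p) (φ p p)) := fun μ κ =>
    hF.tangentProj_eq_tproj (mem_extChartAt_source p) μ κ
  simp only [hP]
  set A := fun γ => fderiv ℝ (tproj (rep m F p)) (φ p p)
    (dpinv (rep m F p) (φ p p) (stdBasis n γ)) with hA
  have hs : ∀ γ μ ν, entry μ ν (A γ) = entry ν μ (A γ) := fun γ μ ν =>
    entry_symm (J.selfAdjoint_d _) μ ν
  set P := tproj (rep m F p) (φ p p)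
  have hmul : ∀ (B C : 𝔼 (Fin n) →L[ℝ] 𝔼 (Fin n)) μ ν,
      entry μ ν (B * C) = ∑ κ, entry μ κ B * entry κ ν C := fun B C μ ν =>
    apply_eq_sum_entry B _ μ
  have h2 : ∀ B : 𝔼 (Fin n) →L[ℝ] 𝔼 (Fin n), entry α β (2 * B) = 2 * entry α β B := fun B => by
    rw [two_mul, map_add, two_mul]
  have h4 : ∀ B : 𝔼 (Fin n) →L[ℝ] 𝔼 (Fin n), entry α β (4 * B) = 4 * entry α β B := fun B => by
    rw [← two_add_two_eq_four, add_mul, map_add, h2, ← two_add_two_eq_four, add_mul]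
  rw [map_sub, h2, h4, map_sum, map_sum]
  change 2 * ∑ μ, ∑ γ, entry α μ (A γ) * entry β μ (A γ) -
    4 * ∑ μ, ∑ κ, entry μ κ P * ∑ γ, entry α μ (A γ) * entry β κ (A γ) =
    2 * ∑ γ, entry α β (A γ * A γ) - 4 * ∑ γ, entry α β (A γ * P * A γ)
  congr 2
  · rw [Finset.sum_comm]
    refine Finset.sum_congr rfl fun γ _ => ?_
    rw [hmul]
    exact Finset.sum_congr rfl fun μ _ => by rw [hs γ β μ]
  · simp only [hmul, Finset.mul_sum, Finset.sum_mul]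
    rw [sum_rotate]
    refine Finset.sum_congr rfl fun γ _ => Finset.sum_congr rfl fun κ _ =>
      Finset.sum_congr rfl fun μ _ => ?_
    rw [hs γ β κ]; ring

theorem f₂_eq (α : Fin n) :
    f₂ m F (tangentProj m F) (meanCurv m F) p α =
      ((2 : ℝ) • ∑ γ, fderiv ℝ (tproj (rep m F p)) (φ p p)
            (dpinv (rep m F p) (φ p p) (stdBasis n γ))
          (fderiv ℝ (mcv (stdBasis n) (rep m F p)) (φ p p)
            (dpinv (rep m F p) (φ p p) (stdBasis n γ)))
        + (4 : ℝ) • ∑ γ, fderiv ℝ (tproj (rep m F p)) (φ p p)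
            (dpinv (rep m F p) (φ p p) (stdBasis n γ))
          (fderiv ℝ (tproj (rep m F p)) (φ p p) (dpinv (rep m F p) (φ p p) (stdBasis n γ))
            (mcv (stdBasis n) (rep m F p) (φ p p)))) α := by
  simp only [f₂, inner_eq_sum, hF.tangGrad_tangentProj, hF.tangGrad_meanCurv,
    hF.meanCurv_eq_mcv (mem_extChartAt_source p)]
  set A := fun γ => fderiv ℝ (tproj (rep m F p)) (φ p p)
    (dpinv (rep m F p) (φ p p) (stdBasis n γ)) with hA
  set H := mcv (stdBasis n) (rep m F p) (φ p p)
  set D := fun γ => fderiv ℝ (mcv (stdBasis n) (rep m F p)) (φ p p)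
    (dpinv (rep m F p) (φ p p) (stdBasis n γ)) with hD
  simp only [PiLp.add_apply, PiLp.smul_apply, WithLp.ofLp_sum, Finset.sum_apply, smul_eq_mul]
  change 2 * ∑ μ, ∑ γ, entry α μ (A γ) * D γ μ +
    4 * ∑ μ, ∑ κ, (∑ γ, entry α μ (A γ) * entry μ κ (A γ)) * H κ =
    2 * ∑ γ, A γ (D γ) α + 4 * ∑ γ, A γ (A γ H) α
  congr 2
  · rw [Finset.sum_comm]
    exact Finset.sum_congr rfl fun γ _ => (apply_eq_sum_entry _ _ _).symm
  · simp only [apply_eq_sum_entry (A _), Finset.mul_sum, Finset.sum_mul]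
    rw [sum_rotate]
    refine Finset.sum_congr rfl fun γ _ => ?_
    rw [Finset.sum_comm]
    exact Finset.sum_congr rfl fun κ _ => Finset.sum_congr rfl fun μ _ => mul_assoc _ _ _

end IsImmersion

namespace IsMeanCurvatureFlow

variable (hT : 0 < T) (hX : IsMeanCurvatureFlow m T X)
include hT hX

/-- First variation of the projection and of the pseudoinverse along the flow. -/
theorem exists_deriv_tproj {t : ℝ} (ht : t ∈ Icc 0 T) (p : M) {y : 𝔼 (Fin m)}
    (hy : y ∈ (φ p).target) :
    ∃ (Pdot : 𝔼 (Fin n) →L[ℝ] 𝔼 (Fin n)) (Rdot : 𝔼 (Fin n) →L[ℝ] 𝔼 (Fin m)),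
      HasDerivWithinAt (fun s => tproj (rep m (X s) p) y) Pdot (Icc 0 T) t ∧
      HasDerivWithinAt (fun s => dpinv (rep m (X s) p) y) Rdot (Icc 0 T) t ∧
      IsSelfAdjoint Pdot ∧
      Pdot * tproj (rep m (X t) p) y + tproj (rep m (X t) p) y * Pdot = Pdot ∧
      (∀ w, Pdot (fderiv ℝ (rep m (X t) p) y w) = (1 - tproj (rep m (X t) p) y)
        (fderiv ℝ (mcv (stdBasis n) (rep m (X t) p)) y w)) ∧
      ∀ x, fderiv ℝ (mcv (stdBasis n) (rep m (X t) p)) y (dpinv (rep m (X t) p) y x)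
        + fderiv ℝ (rep m (X t) p) y (Rdot x) = Pdot x := by
  have hu := uniqueDiffOn_Icc hT t ht
  have hG := fun {s} (hs : s ∈ Icc 0 T) => (hX.isImmersion hs).smoothImmersionOn p
  have hL := hasDerivWithinAt_fderiv (f := fun s => rep m (X s) p) hT (isOpen_target p)
    (hX.contDiffOn_rep p) ht (fun z hz => hX.velocity_rep ht p hz) hy
  have hinj := (hG ht).injective y hy
  have hR : HasDerivWithinAt (fun s => dpinv (rep m (X s) p) y) _ (Icc 0 T) t :=
    (((contDiffAt_pinv hinj (n := 1)).differentiableAt (by simp)).hasFDerivAt).comp_hasDerivWithinAt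
      t hL
  have hP : HasDerivWithinAt (fun s => tproj (rep m (X s) p) y) _ (Icc 0 T) t := hL.clm_comp hR
  -- `Rdot` comes from the chain rule through the smooth map `pinv`, and `Pdot` from the product
  -- rule for `L R`, so the last relation is definitional. The others differentiate `P† = P`, `P² =
  -- P` and `P L = L`, using uniqueness of derivatives on the interval.
  refine ⟨_, _, hP, hR, ?_, ?_, fun w => ?_, fun x => rfl⟩
  · have h1 : ∀ s ∈ Icc 0 T, tproj (rep m (X s) p) y = star (tproj (rep m (X s) p) y) :=
      fun s hs => ((hG hs).jet hy).selfAdjoint.star_eq.symm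
    exact (hu.eq_deriv _ hP (hP.star.congr h1 (h1 t ht))).symm
  · have h1 : ∀ s ∈ Icc 0 T, tproj (rep m (X s) p) y =
        tproj (rep m (X s) p) y * tproj (rep m (X s) p) y :=
      fun s hs => ((hG hs).jet hy).idem.symm
    exact (hu.eq_deriv _ hP ((hP.mul hP).congr h1 (h1 t ht))).symm
  · have h1 : ∀ s ∈ Icc 0 T, fderiv ℝ (rep m (X s) p) y w =
        tproj (rep m (X s) p) y (fderiv ℝ (rep m (X s) p) y w) :=
      fun s hs => (((hG hs).jet hy).P_L w).symm
    have h2 := hL.clm_apply (hasDerivWithinAt_const t (Icc 0 T) w)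
    have h3 := hu.eq_deriv _ h2 ((hP.clm_apply h2).congr h1 (h1 t ht))
    simp only [map_zero, add_zero] at h3
    exact eq_sub_of_add_eq h3.symm

theorem proj_evolution {t : ℝ} (ht : t ∈ Icc 0 T) (p : M) (α β : Fin n) :
    HasDerivWithinAt (fun s => tangentProj m (X s) p α β)
      (laplaceBeltrami m (X t) (fun q => tangentProj m (X t) q α β) p
        + f₁ m (X t) (tangentProj m (X t)) p α β) (Icc 0 T) t := by
  have hy := mem_extChartAt_target (I := 𝓘(ℝ, 𝔼 (Fin m))) p
  have hF := hX.isImmersion ht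
  obtain ⟨Pdot, Rdot, hP, -, hsa, hidem, hL, -⟩ := hX.exists_deriv_tproj hT ht p hy
  have hG := hF.smoothImmersionOn p
  have h1 := (hG.jet hy).proj_evolution (stdBasis n) (hG.fderiv_mcv _ hy) hsa hidem hL
  rw [← hG.lap_eq _ hG.contDiffOn_tproj hy] at h1
  rw [hF.laplaceBeltrami_tangentProj, hF.f₁_eq, ← map_add, ← h1]
  have h2 := (entry α β).hasFDerivAt.comp_hasDerivWithinAt t hP
  exact h2.congr (fun s hs => (hX.isImmersion hs).tangentProj_eq_tproj (mem_extChartAt_source p) α β)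
    (hF.tangentProj_eq_tproj (mem_extChartAt_source p) α β)

theorem meanCurv_evolution {t : ℝ} (ht : t ∈ Icc 0 T) (p : M) (α : Fin n) :
    HasDerivWithinAt (fun s => meanCurv m (X s) p α)
      (laplaceBeltrami m (X t) (fun q => meanCurv m (X t) q α) p
        + f₂ m (X t) (tangentProj m (X t)) (meanCurv m (X t)) p α) (Icc 0 T) t := by
  have hy := mem_extChartAt_target (I := 𝓘(ℝ, 𝔼 (Fin m))) p
  have hF := hX.isImmersion ht
  obtain ⟨Pdot, Rdot, hP, hR, hsa, hidem, hL, hLR⟩ := hX.exists_deriv_tproj hT ht p hy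
  have hG := hF.smoothImmersionOn p
  have h1 := (hG.jet hy).proj_evolution (stdBasis n) (hG.fderiv_mcv _ hy) hsa hidem hL
  have h2 := (hG.jet hy).meanCurv_evolution (stdBasis n)
    (H := mcv (stdBasis n) (rep m (X t) p) (φ p p)) rfl (hG.tproj_fderiv_mcv _ hy)
    (hG.tproj_fderiv_fderiv_mcv _ hy) hL hLR h1
  rw [← hG.lap_eq _ (hG.contDiffOn_mcv _) hy] at h2
  -- Commuting time and space derivatives twice: the time derivative of `Q` is the second derivative
  -- of `H`.
  have hQ := hasDerivWithinAt_fderiv (f := fun s => fderiv ℝ (rep m (X s) p)) hT (isOpen_target p)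
    (contDiffOn_fderiv_slab (f := fun s => rep m (X s) p) hT (isOpen_target p)
      (hX.contDiffOn_rep p)) ht
    (fun z hz => hasDerivWithinAt_fderiv (f := fun s => rep m (X s) p) hT (isOpen_target p)
      (hX.contDiffOn_rep p) ht (fun z hz => hX.velocity_rep ht p hz) hz) hy
  have hRe := fun γ => hR.clm_apply (hasDerivWithinAt_const t (Icc 0 T) (stdBasis n γ))
  -- The product rule for `∑ (1 - P) Q(R e, R e)`, the form of the mean curvature in which every
  -- factor has a known time derivative.
  have h3 := HasDerivWithinAt.fun_sum (u := Finset.univ) fun γ _ =>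
    (hP.const_sub (1 : 𝔼 (Fin n) →L[ℝ] 𝔼 (Fin n))).clm_apply
      ((hQ.clm_apply (hRe γ)).clm_apply (hRe γ))
  rw [hF.laplaceBeltrami_meanCurv, hF.f₂_eq, ← PiLp.add_apply, ← h2]
  have h4 := h3.congr (fun s hs => (hX.isImmersion hs).meanCurv_eq_sum p) (hF.meanCurv_eq_sum p)
  have h5 := (EuclideanSpace.proj α : 𝔼 (Fin n) →L[ℝ] ℝ).hasFDerivAt.comp_hasDerivWithinAt t h4
  refine h5.congr_deriv (congrArg (fun v : 𝔼 (Fin n) => v α) (Finset.sum_congr rfl fun γ _ => ?_))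
  simp only [map_zero, add_zero, add_apply, neg_apply]

end IsMeanCurvatureFlow
end Evolution
end HigherCodimMCF

open HigherCodimMCF
theorem lemma2p1 {m n : ℕ} {M : Type*} [TopologicalSpace M]
    [ChartedSpace (EuclideanSpace ℝ (Fin m)) M]
    [IsManifold 𝓘(ℝ, EuclideanSpace ℝ (Fin m)) ∞ M]
    (T : ℝ) (hT : 0 < T) (X : ℝ → M → EuclideanSpace ℝ (Fin n))
    (hX : IsMeanCurvatureFlow m T X) :
    ∀ t ∈ Icc 0 T, ∀ p : M,
      (∀ α β : Fin n,
        HasMaterialDeriv T (fun s q => tangentProj m (X s) q α β)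
          (laplaceBeltrami m (X t) (fun q => tangentProj m (X t) q α β) p
            + f₁ m (X t) (tangentProj m (X t)) p α β) t p) ∧
      (∀ α : Fin n,
        HasMaterialDeriv T (fun s q => meanCurv m (X s) q α)
          (laplaceBeltrami m (X t) (fun q => meanCurv m (X t) q α) p
            + f₂ m (X t) (tangentProj m (X t)) (meanCurv m (X t)) p α) t p) :=
  fun _ ht p => ⟨hX.proj_evolution hT ht p, hX.meanCurv_evolution hT ht p⟩
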